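/- Let $D\subset\mathbb R^2$ be open with finite measure. Let $g=(g_{ij}):\mathbb R^n\to\mathbb R^{n\times n}$ be pointwise symmetric and positive definite with $g,g^{-1}\in W^{1,\infty}(\mathbb R^n)$ (bounded and Lipschitz representatives), let $b_{ij}\in W^{1,2}(D)$, and let $\Omega_{ij}=-\Omega_{ji}\in L^2(D,\mathbb R^2)$ $(1\le i,j\le n)$. Let $u\in W^{1,2}(D,\mathbb R^n)$ be such that for a.e. $x\in D$ with $\nabla u(x)\ne 0$ the map $g$ is differentiable at $u(x)$, so that $(\partial_i g_{kl})(u)\nabla u^k\cdot\nabla u^l$ is well defined a.e. (this is automatic if $g\in C^1$). Suppose that $u$ is a weak solution in $D$ (tested with $C_c^\infty(D)$; repeated indices are summed; $\nabla^\perp=(-\partial_2,\partial_1)$) of $$-\operatorname{div}\big(2g_{ik}(u)\nabla u^k\big)+(\partial_i g_{kl})(u)\,\nabla u^k\cdot\nabla u^l=\Omega_{ik}\cdot\nabla u^k+\nabla^\perp b_{ik}\cdot\nabla u^k,\qquad 1\le i\le n.$$ Then there are $e\in W^{1,\infty}(\mathbb R^n,\mathbb R^{n\times n})$ with $e^{T}e=g$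 on $\mathbb R^n$ and $\widetilde\Omega_{ij}=-\widetilde\Omega_{ji}\in L^2(D,\mathbb R^2)$ such that $A:=e(u)$ takes values in $GL(n)$, satisfies $A,A^{-1}\in W^{1,2}\cap L^\infty(D,\mathbb R^{n\times n})$, and, weakly in $D$, $$\operatorname{div}\big(A_{ik}\nabla u^k\big)=\widetilde\Omega_{ik}\cdot A_{kl}\nabla u^l-\tfrac12\,(A^{-1})_{ji}\,\nabla^\perp b_{jk}\cdot\nabla u^k,\qquad 1\le i\le n.$$ -/

import Mathlib

open MeasureTheory
open scoped ContDiff NNReal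

noncomputable section

namespace RiviereForm

/-- The plane with its Euclidean norm. -/
abbrev Plane : Type := EuclideanSpace ℝ (Fin 2)

/-- `φ` is a real test function on `D`: smooth, with compact support contained in `D`. -/
def IsTest (D : Set Plane) (φ : Plane → ℝ) : Prop :=
  ContDiff ℝ ∞ φ ∧ HasCompactSupport φ ∧ tsupport φ ⊆ D

/-- `F` is a weak gradient of `f` on `D`. -/
def IsWeakGrad (D : Set Plane) (f : Plane → ℝ) (F : Plane → Plane) : Prop :=
  LocallyIntegrableOn f D ∧ LocallyIntegrableOn F D ∧
    ∀ φ : Plane → ℝ, IsTest D φ →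
      ∫ x in D, f x • gradient φ x = -∫ x in D, φ x • F x

/-- `f` belongs to `W^{1,2}(D)` and `F` is (a version of) its gradient. -/
def HasW12Grad (D : Set Plane) (f : Plane → ℝ) (F : Plane → Plane) : Prop :=
  MemLp f 2 (volume.restrict D) ∧ MemLp F 2 (volume.restrict D) ∧ IsWeakGrad D f F

/-- `f ∈ W^{1,2}(D)`. -/
def MemW12 (D : Set Plane) (f : Plane → ℝ) : Prop :=
  ∃ F : Plane → Plane, HasW12Grad D f F

/-- `div X = f` weakly on `D`. -/
def IsWeakDiv (D : Set Plane) (X : Plane → Plane) (f : Plane → ℝ) : Prop :=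
  LocallyIntegrableOn X D ∧ LocallyIntegrableOn f D ∧
    ∀ φ : Plane → ℝ, IsTest D φ →
      ∫ x in D, inner ℝ (X x) (gradient φ x) = -∫ x in D, f x * φ x

/-- `f ∈ W^{1,∞}(ℝⁿ)`, for the continuous representative `f`: bounded and Lipschitz.
(Each class in `W^{1,∞}(ℝⁿ)` has exactly one continuous representative, and it is of this kind;
the composition `f ∘ u` is always taken with this representative.) -/
def MemW1inf {n : ℕ} (f : EuclideanSpace ℝ (Fin n) → ℝ) : Prop :=
  (∃ K : ℝ≥0, LipschitzWith K f) ∧ ∃ C : ℝ, ∀ y, |f y| ≤ C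

/-- The partial derivative `∂ᵢ f (y)`. -/
def pderiv {n : ℕ} (i : Fin n) (f : EuclideanSpace ℝ (Fin n) → ℝ)
    (y : EuclideanSpace ℝ (Fin n)) : ℝ :=
  fderiv ℝ f y (EuclideanSpace.single i 1)

/-- Rotation by a right angle; it sends `∇b = (∂₁b, ∂₂b)` to `∇^⊥ b = (-∂₂b, ∂₁b)`. -/
def perp (v : Plane) : Plane := !₂[-v 1, v 0]

/-- The function `∑ₖ ∇^⊥ b_{ik} · ∇u^k`, where `db i k = ∇b_{ik}` and `du k = ∇u^k`. -/
def perpTerm {n : ℕ} (db : Fin n → Fin n → Plane → Plane) (du : Fin n → Plane → Plane)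
    (i : Fin n) (x : Plane) : ℝ :=
  ∑ k, inner ℝ (perp (db i k x)) (du k x)

/-- `u` (with gradient `du`) is a weak solution on `D` of the system, `1 ≤ i ≤ n`,
`-div (2 g_{ik}(u) ∇u^k) + (∂ᵢ g_{kl})(u) ∇u^k · ∇u^l = Ω_{ik} · ∇u^k + ∇^⊥ b_{ik} · ∇u^k`. -/
def IsWeakSolution {n : ℕ} (D : Set Plane)
    (g : EuclideanSpace ℝ (Fin n) → Matrix (Fin n) (Fin n) ℝ)
    (Ω : Fin n → Fin n → Plane → Plane) (db : Fin n → Fin n → Plane → Plane)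
    (u : Plane → EuclideanSpace ℝ (Fin n)) (du : Fin n → Plane → Plane) : Prop :=
  ∀ i : Fin n, IsWeakDiv D
    (fun x => -∑ k, (2 * g (u x) i k) • du k x)
    (fun x => ∑ k, inner ℝ (Ω i k x) (du k x) + perpTerm db du i x
      - ∑ k, ∑ l, pderiv i (fun y => g y k l) (u x) * inner ℝ (du k x) (du l x))

/-- `Ω_{ij} ∈ L²(D, ℝ²)` and `Ω_{ij} = -Ω_{ji}` almost everywhere on `D`. -/
def IsAntisymmL2 {n : ℕ} (D : Set Plane) (Ω : Fin n → Fin n → Plane → Plane) : Prop :=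
  (∀ i j, MemLp (Ω i j) 2 (volume.restrict D)) ∧
    ∀ i j, ∀ᵐ x ∂(volume.restrict D), Ω i j x = -Ω j i x

end RiviereForm

end

/-! Take `e` to be the positive square root of `g`, and write A = e(u), B = A⁻¹, w = A∇u. Since
BᵀAᵀA = A, multiplying the j-th equation by B_{ji}, summing over j and scaling by -1/2 turns the
divergence part into div w_i. The remaining terms are those of the equation and those in which the
derivative falls on B. Differentiating g = eᵀe and e e⁻¹ = 1 expresses all of them through the
derivatives of `e`. They combine into Bᵀ ω with ω_{jk} = ∑ₚ (∂_j e_{pk} - ∂_k e_{pj}) w_p -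
Ω_{jk}/2, contracted with ∇u = Bw. This ω is antisymmetric, hence so is Ω̃ = BᵀωB. It is in L²
because ∂e and B are bounded and w, Ω are in L². The perpendicular gradient terms are merely
multiplied by Bᵀ.

Three analytic points make this rigorous.

Regularity of the root: e(y)² - e(z)² is the Sylvester operator X ↦ e(y)X + Xe(z) applied to e(y) -
e(z), and the bound on g⁻¹ makes this operator uniformly bounded below (`le_norm_sylvester`). So `e`
is Lipschitz, and linearising with a quadratic remainder shows that `e` is differentiable wherever
`g` is (`differentiableAt_sqrt`).

Chain rule: f(u) must be differentiated for f merely Lipschitz, and differentiable only at the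
values u(x) with ∇u(x) ≠ 0. Difference quotients of a Sobolev function converge in L¹, so f(u(x +
tv)) may be replaced by f(u(x) + t∂_v u(x)) at a cost o(t) in L¹; dominated convergence does the
rest (`integral_fderiv_smul_comp`, `hasW12Grad_comp`).

Product rule: the right-hand side is only in L¹, being quadratic in ∇u, so multiplying by B means
testing with φB in L^∞ ∩ W^{1,2}. Mollification justifies this (`integral_inner_weakGrad`,
`IsWeakDiv.mul`). -/

namespace RiviereForm

open Filter Topology
open scoped Convolution ENNReal

/-! ### Difference quotients of Sobolev functions in L¹. -/

section Translations

variable {E : Type*} [NormedAddCommGroup E] [NormedSpace ℝ E]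

/-- `Ψ` is the weak derivative of `ψ` in direction `v` on the whole plane. -/
def IsWeakDeriv (v : Plane) (ψ Ψ : Plane → E) : Prop :=
  ∀ φ : Plane → ℝ, ContDiff ℝ ∞ φ → HasCompactSupport φ →
    ∫ x, fderiv ℝ φ x v • ψ x = -∫ x, φ x • Ψ x

theorem _root_.ContDiff.fderiv_apply_const {φ : Plane → ℝ} (hφ : ContDiff ℝ ∞ φ) (v : Plane) :
    ContDiff ℝ ∞ (fun x => fderiv ℝ φ x v) :=
  (hφ.fderiv_right (m := ∞) (by simp)).clm_apply contDiff_const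

theorem _root_.HasCompactSupport.smul_locallyIntegrable {φ : Plane → ℝ} {ψ : Plane → E}
    (hφ : Continuous φ) (hc : HasCompactSupport φ) (hψ : LocallyIntegrable ψ) :
    Integrable (fun x => φ x • ψ x) :=
  hψ.integrable_smul_left_of_hasCompactSupport hφ hc

theorem integral_smul_add_left (φ : Plane → ℝ) (ψ : Plane → E) (y : Plane) :
    ∫ x, φ x • ψ (y + x) = ∫ x, φ (x - y) • ψ x := by
  rw [← integral_add_left_eq_self (fun x => φ (x - y) • ψ x) y]
  simp

/-- Correlations with a test function may be differentiated under the integral sign. -/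
theorem hasDerivAt_integral_smul_translate [CompleteSpace E] {φ : Plane → ℝ}
    (hφ : ContDiff ℝ ∞ φ) (hc : HasCompactSupport φ) {ψ : Plane → E} (hψ : LocallyIntegrable ψ)
    (v : Plane) (s : ℝ) :
    HasDerivAt (fun s : ℝ => ∫ x, φ x • ψ (s • v + x))
      (-∫ x, fderiv ℝ φ x v • ψ (s • v + x)) s := by
  -- As a function of the shift, the correlation is the convolution of ψ with the reflection of φ,
  -- so smoothness comes from the convolution.
  set φ' : Plane → ℝ := fun x => φ (-x) with hφ'
  have hs' : ContDiff ℝ ∞ φ' := hφ.comp contDiff_neg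
  have hc' : HasCompactSupport φ' := hc.comp_homeomorph (Homeomorph.neg Plane)
  set L : E →L[ℝ] ℝ →L[ℝ] E := (ContinuousLinearMap.lsmul ℝ ℝ).flip
  have h1 := hc'.hasFDerivAt_convolution_right L hψ (hs'.of_le (by simp)) (s • v)
  have h2 : HasDerivAt (fun s : ℝ => s • v) v s := by
    simpa using (hasDerivAt_id s).smul_const v
  have h3 := h1.comp_hasDerivAt s h2
  have e1 : (fun s : ℝ => ∫ x, φ x • ψ (s • v + x)) = (ψ ⋆[L] φ') ∘ (fun s : ℝ => s • v) := by
    ext s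
    rw [integral_smul_add_left]
    simp [convolution_def, L, φ']
  rw [e1]
  convert h3 using 1
  rw [convolution_precompR_apply L hψ (hc'.fderiv ℝ) (hs'.continuous_fderiv (by simp)),
    integral_smul_add_left, convolution_def, ← integral_neg]
  refine integral_congr_ae (Eventually.of_forall fun x => ?_)
  have : fderiv ℝ φ' (s • v - x) = - fderiv ℝ φ (x - s • v) := by
    have h4 : HasFDerivAt φ (fderiv ℝ φ (x - s • v)) (-(s • v - x)) := by
      rw [neg_sub]
      exact (hφ.differentiable (by simp) _).hasFDerivAt
    have h5 : HasFDerivAt φ' _ (s • v - x) := h4.comp (s • v - x) (hasFDerivAt_id _).neg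
    rw [h5.fderiv]
    ext w
    simp
  simp [L, this]

/-- Pairing of integrable functions with a bounded continuous weight. -/
theorem exists_clm_integral_smul {φ : Plane → ℝ} (hφ : Continuous φ) (hc : HasCompactSupport φ) :
    ∃ ℓ : Lp E 1 (volume : Measure Plane) →L[ℝ] E, ∀ f, ℓ f = ∫ x, φ x • f x := by
  obtain ⟨C, hC⟩ := hc.exists_bound_of_continuous hφ
  have hint : ∀ f : Lp E 1 (volume : Measure Plane), Integrable (fun x => φ x • f x) := fun f =>
    (L1.integrable_coeFn f).bdd_smul C hφ.aestronglyMeasurable (Eventually.of_forall hC)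
  refine ⟨LinearMap.mkContinuous
    { toFun := fun f => ∫ x, φ x • f x
      map_add' := fun f g => ?_
      map_smul' := fun c f => ?_ } C fun f => ?_, fun f => rfl⟩
  · rw [← integral_add (hint f) (hint g)]
    refine integral_congr_ae ?_
    filter_upwards [Lp.coeFn_add f g] with x hx
    rw [hx, Pi.add_apply, smul_add]
  · rw [RingHom.id_apply, ← integral_smul]
    refine integral_congr_ae ?_
    filter_upwards [Lp.coeFn_smul c f] with x hx
    rw [hx, Pi.smul_apply, smul_comm]
  · change ‖∫ x, φ x • f x‖ ≤ C * ‖f‖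
    rw [L1.norm_eq_integral_norm, ← integral_const_mul]
    refine norm_integral_le_of_norm_le ((L1.integrable_coeFn f).norm.const_mul C)
      (Eventually.of_forall fun x => ?_)
    rw [norm_smul]
    exact mul_le_mul_of_nonneg_right (hC x) (norm_nonneg _)

/-- Difference quotients of a function with an integrable weak derivative converge in `L¹`. -/
theorem IsWeakDeriv.tendsto_integral_norm_slope [CompleteSpace E] {v : Plane} {ψ Ψ : Plane → E}
    (h : IsWeakDeriv v ψ Ψ) (hψ : Integrable ψ) (hΨ : Integrable Ψ) :
    Tendsto (fun t : ℝ => ∫ x, ‖t⁻¹ • (ψ (t • v + x) - ψ x) - Ψ x‖) (𝓝[≠] 0) (𝓝 0) := by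
  have : Fact ((1 : ℝ≥0∞) ≠ ⊤) := ⟨ENNReal.one_ne_top⟩
  have mψ := memLp_one_iff_integrable.2 hψ
  have mΨ := memLp_one_iff_integrable.2 hΨ
  set f := mψ.toLp ψ with hf
  set F := mΨ.toLp Ψ with hF
  let τ : ℝ → Lp E 1 (volume : Measure Plane) → Lp E 1 (volume : Measure Plane) :=
    fun s f => DomAddAct.mk (s • v) +ᵥ f
  have hτf : ∀ s, τ s f =ᵐ[volume] fun x => ψ (s • v + x) := fun s => by
    simp only [τ, hf, DomAddAct.mk_vadd_toLp]
    exact MemLp.coeFn_toLp _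
  have hτF : ∀ s, τ s F =ᵐ[volume] fun x => Ψ (s • v + x) := fun s => by
    simp only [τ, hF, DomAddAct.mk_vadd_toLp]
    exact MemLp.coeFn_toLp _
  have hcont : Continuous fun s => τ s F := by
    have : Continuous fun s : ℝ => (DomAddAct.mk (s • v) : Planeᵈᵃᵃ) :=
      DomAddAct.continuous_mk.comp (by fun_prop)
    exact this.vadd continuous_const
  have h0 : ∀ f, τ 0 f = f := fun f => by
    simp only [τ, zero_smul]
    exact zero_vadd _ f
  -- Fundamental theorem of calculus along the orbit of translations, as a Bochner integral in L¹.
  -- It suffices to pair both sides with test functions, where the weak derivative identity for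
  -- shifted tests gives the derivative of the pairing.
  have key : ∀ t : ℝ, ∫ s in (0 : ℝ)..t, τ s F = τ t f - f := by
    intro t
    rw [Lp.ext_iff]
    refine ae_eq_of_integral_contDiff_smul_eq (L1.integrable_coeFn _).locallyIntegrable
      (L1.integrable_coeFn _).locallyIntegrable fun φ hφ hc => ?_
    obtain ⟨ℓ, hℓ⟩ := exists_clm_integral_smul (E := E) hφ.continuous hc
    rw [← hℓ, ← hℓ, map_sub, ← ℓ.intervalIntegral_comp_comm (hcont.intervalIntegrable _ _)]
    have hder : ∀ s : ℝ, HasDerivAt (fun s => ℓ (τ s f)) (ℓ (τ s F)) s := by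
      intro s
      have e1 : (fun s => ℓ (τ s f)) = fun s : ℝ => ∫ x, φ x • ψ (s • v + x) := by
        ext s
        rw [hℓ]
        refine integral_congr_ae ?_
        filter_upwards [hτf s] with x hx
        rw [hx]
      have e2 : ℓ (τ s F) = -∫ x, fderiv ℝ φ x v • ψ (s • v + x) := by
        rw [hℓ, integral_smul_add_left (fun x => fderiv ℝ φ x v)]
        have h3 := h (fun x => φ (x - s • v)) (hφ.comp (contDiff_id.sub contDiff_const))
          (hc.comp_homeomorph (Homeomorph.subRight (s • v)))
        simp only [fderiv_comp_sub] at h3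
        rw [h3, neg_neg, ← integral_smul_add_left]
        refine integral_congr_ae ?_
        filter_upwards [hτF s] with x hx
        rw [hx]
      rw [e1, e2]
      exact hasDerivAt_integral_smul_translate hφ hc hψ.locallyIntegrable v s
    rw [intervalIntegral.integral_eq_sub_of_hasDerivAt (fun s _ => hder s)
      ((ℓ.continuous.comp hcont).intervalIntegrable _ _), h0]
  -- Translation is continuous in L¹, so the integral is differentiable at 0 with derivative F; by
  -- `key` its slopes are the difference quotients of f.
  have hD : HasDerivAt (fun t => ∫ s in (0 : ℝ)..t, τ s F) (τ 0 F) 0 :=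
    intervalIntegral.integral_hasDerivAt_right (by simp)
      (hcont.stronglyMeasurableAtFilter _ _) hcont.continuousAt
  rw [hasDerivAt_iff_tendsto_slope_zero, h0] at hD
  have h1 := tendsto_iff_norm_sub_tendsto_zero.1 hD
  refine h1.congr fun t => ?_
  simp only [zero_add, intervalIntegral.integral_same, sub_zero]
  rw [key, L1.norm_eq_integral_norm]
  refine integral_congr_ae ?_
  filter_upwards [Lp.coeFn_sub (t⁻¹ • (τ t f - f)) F, Lp.coeFn_smul t⁻¹ (τ t f - f),
    Lp.coeFn_sub (τ t f) f, hτf t, mψ.coeFn_toLp, mΨ.coeFn_toLp] with x h1 h2 h3 h4 h5 h6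
  rw [h1, Pi.sub_apply, h2, Pi.smul_apply, h3, Pi.sub_apply, h4, h5, h6]

end Translations

/-! ### Localisation by test functions and the chain rule for Lipschitz functions. -/

section ChainRule

theorem IsTest.integrable_mul {D S : Set Plane} {φ f : Plane → ℝ} (hφ : IsTest D φ)
    (hf : IntegrableOn f S) : IntegrableOn (fun x => φ x * f x) S := by
  obtain ⟨C, hC⟩ := hφ.2.1.exists_bound_of_continuous hφ.1.continuous
  exact hf.bdd_mul (c := C) hφ.1.continuous.aestronglyMeasurable (Eventually.of_forall hC)

theorem IsTest.fderiv_apply {D : Set Plane} {φ : Plane → ℝ} (hφ : IsTest D φ) (v : Plane) :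
    IsTest D (fun x => fderiv ℝ φ x v) :=
  ⟨hφ.1.fderiv_apply_const v, hφ.2.1.fderiv_apply (𝕜 := ℝ) v,
    (tsupport_fderiv_apply_subset ℝ v).trans hφ.2.2⟩

theorem IsTest.mul_contDiff {D : Set Plane} {φ η : Plane → ℝ} (hφ : IsTest D φ)
    (hη : ContDiff ℝ ∞ η) : IsTest D (fun x => φ x * η x) :=
  ⟨hφ.1.mul hη, hφ.2.1.mul_right, (tsupport_mul_subset_left).trans hφ.2.2⟩

theorem IsTest.apply_eq_zero {D : Set Plane} {φ : Plane → ℝ} (hφ : IsTest D φ) {x : Plane}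
    (hx : x ∉ D) : φ x = 0 :=
  image_eq_zero_of_notMem_tsupport fun h => hx (hφ.2.2 h)

theorem inner_gradient (φ : Plane → ℝ) (x v : Plane) :
    inner ℝ v (gradient φ x) = fderiv ℝ φ x v := by
  rw [real_inner_comm, gradient, InnerProductSpace.toDual_symm_apply]

theorem continuous_gradient {φ : Plane → ℝ} (hφ : ContDiff ℝ ∞ φ) : Continuous (gradient φ) :=
  (InnerProductSpace.toDual ℝ Plane).symm.continuous.comp (hφ.continuous_fderiv (by simp))

theorem IsTest.exists_bound_gradient {D : Set Plane} {φ : Plane → ℝ} (hφ : IsTest D φ) :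
    ∃ C, ∀ x, ‖gradient φ x‖ ≤ C := by
  obtain ⟨C, hC⟩ := (hφ.2.1.fderiv ℝ).exists_bound_of_continuous
    (hφ.1.continuous_fderiv (by simp))
  exact ⟨C, fun x => by rw [gradient, LinearIsometryEquiv.norm_map]; exact hC x⟩

/-- Weak gradients of integrable functions can be tested one direction at a time. -/
theorem isWeakGrad_iff {D : Set Plane} {f : Plane → ℝ} {F : Plane → Plane}
    (hf : IntegrableOn f D) (hF : IntegrableOn F D) :
    IsWeakGrad D f F ↔ ∀ φ : Plane → ℝ, IsTest D φ → ∀ v,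
      ∫ x in D, fderiv ℝ φ x v * f x = -∫ x in D, φ x * inner ℝ v (F x) := by
  have key : ∀ φ : Plane → ℝ, IsTest D φ → ∀ v,
      inner ℝ v (∫ x in D, f x • gradient φ x) = ∫ x in D, fderiv ℝ φ x v * f x ∧
      inner ℝ v (-∫ x in D, φ x • F x) = -∫ x in D, φ x * inner ℝ v (F x) := by
    intro φ hφ v
    obtain ⟨C, hC⟩ := hφ.2.1.exists_bound_of_continuous hφ.1.continuous
    obtain ⟨C', hC'⟩ := hφ.exists_bound_gradient
    have h1 : IntegrableOn (fun x => f x • gradient φ x) D :=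
      hf.smul_bdd C' (continuous_gradient hφ.1).aestronglyMeasurable (Eventually.of_forall hC')
    have h2 : IntegrableOn (fun x => φ x • F x) D :=
      hF.bdd_smul C hφ.1.continuous.aestronglyMeasurable (Eventually.of_forall hC)
    constructor
    · rw [← integral_inner h1]
      simp only [inner_smul_right, inner_gradient, mul_comm]
    · rw [inner_neg_right, ← integral_inner h2]
      simp only [inner_smul_right]
  constructor
  · intro h φ hφ v
    rw [← (key φ hφ v).1, ← (key φ hφ v).2, h.2.2 φ hφ]
  · refine fun h => ⟨hf.locallyIntegrableOn, hF.locallyIntegrableOn, fun φ hφ => ?_⟩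
    refine ext_inner_left ℝ fun v => ?_
    rw [(key φ hφ v).1, (key φ hφ v).2, h φ hφ v]

theorem HasW12Grad.integrableOn {D : Set Plane} (hD : volume D < ⊤) {f : Plane → ℝ}
    {F : Plane → Plane} (h : HasW12Grad D f F) : IntegrableOn f D ∧ IntegrableOn F D := by
  have : IsFiniteMeasure (volume.restrict D) := ⟨by simpa using hD⟩
  exact ⟨h.1.integrable (by norm_num), h.2.1.integrable (by norm_num)⟩

theorem IsTest.integrable_mul_of_integrableOn {D : Set Plane} {φ f : Plane → ℝ} (hφ : IsTest D φ)
    (hf : IntegrableOn f D) : Integrable (fun x => φ x * f x) := by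
  refine (integrableOn_iff_integrable_of_support_subset fun x hx => ?_).1 (hφ.integrable_mul hf)
  by_contra h
  exact hx (by simp [hφ.apply_eq_zero h])

theorem IsTest.setIntegral_mul {D : Set Plane} {φ : Plane → ℝ} (hφ : IsTest D φ) (f : Plane → ℝ) :
    ∫ x in D, φ x * f x = ∫ x, φ x * f x :=
  setIntegral_eq_integral_of_forall_compl_eq_zero fun x hx => by simp [hφ.apply_eq_zero hx]

/-- Multiplication by a test function gives a function with a weak derivative on the plane. -/
theorem HasW12Grad.isWeakDeriv_mul {D : Set Plane} (hD : volume D < ⊤) {f : Plane → ℝ}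
    {F : Plane → Plane} (h : HasW12Grad D f F) {χ : Plane → ℝ} (hχ : IsTest D χ) (v : Plane) :
    IsWeakDeriv v (fun x => χ x * f x)
      (fun x => χ x * inner ℝ v (F x) + fderiv ℝ χ x v * f x) := by
  obtain ⟨hf, hF⟩ := h.integrableOn hD
  have hFv : IntegrableOn (fun x => inner ℝ v (F x)) D := hF.const_inner v
  intro φ hφ hc
  have hχφ := hχ.mul_contDiff hφ
  have h1 := (isWeakGrad_iff hf hF).1 h.2.2 _ hχφ v
  have hχφ' := hχ.mul_contDiff (hφ.fderiv_apply_const v)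
  have hχ'φ := (hχ.fderiv_apply v).mul_contDiff hφ
  rw [(hχφ.fderiv_apply v).setIntegral_mul, hχφ.setIntegral_mul] at h1
  have e1 : ∀ x, fderiv ℝ (fun x => χ x * φ x) x v * f x
      = χ x * fderiv ℝ φ x v * f x + fderiv ℝ χ x v * φ x * f x := fun x => by
    rw [fderiv_fun_mul (hχ.1.differentiable (by simp) x) (hφ.differentiable (by simp) x)]
    simp only [add_apply, smul_apply, smul_eq_mul]
    ring
  simp only [e1] at h1
  have i1 := hχφ'.integrable_mul_of_integrableOn hf
  have i2 := hχ'φ.integrable_mul_of_integrableOn hf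
  have i3 := hχφ.integrable_mul_of_integrableOn hFv
  rw [integral_add i1 i2] at h1
  have e2 : ∀ x, φ x • (χ x * inner ℝ v (F x) + fderiv ℝ χ x v * f x)
      = χ x * φ x * inner ℝ v (F x) + fderiv ℝ χ x v * φ x * f x := fun x => by
    rw [smul_eq_mul]; ring
  have e3 : ∀ x, fderiv ℝ φ x v • (χ x * f x) = χ x * fderiv ℝ φ x v * f x := fun x => by
    rw [smul_eq_mul]; ring
  simp only [e2, e3]
  rw [integral_add i3 i2]
  linarith

variable {E : Type*} [NormedAddCommGroup E] [NormedSpace ℝ E]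

theorem IsWeakDeriv.smul_const [CompleteSpace E] {v : Plane} {ψ Ψ : Plane → ℝ}
    (h : IsWeakDeriv v ψ Ψ) (c : E) :
    IsWeakDeriv v (fun x => ψ x • c) (fun x => Ψ x • c) := by
  intro φ hφ hc
  have := h φ hφ hc
  simp only [smul_eq_mul] at this
  simp only [smul_smul, integral_smul_const, this, neg_smul]

theorem IsWeakDeriv.sum {ι : Type*} {s : Finset ι} {v : Plane} {ψ Ψ : ι → Plane → E}
    (h : ∀ i ∈ s, IsWeakDeriv v (ψ i) (Ψ i)) (hψ : ∀ i ∈ s, Integrable (ψ i))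
    (hΨ : ∀ i ∈ s, Integrable (Ψ i)) :
    IsWeakDeriv v (fun x => ∑ i ∈ s, ψ i x) (fun x => ∑ i ∈ s, Ψ i x) := by
  intro φ hφ hc
  simp only [Finset.smul_sum]
  rw [integral_finsetSum, integral_finsetSum, ← Finset.sum_neg_distrib]
  · exact Finset.sum_congr rfl fun i hi => h i hi φ hφ hc
  · exact fun i hi => hc.smul_locallyIntegrable hφ.continuous (hΨ i hi).locallyIntegrable
  · exact fun i hi => (hc.fderiv_apply (𝕜 := ℝ) v).smul_locallyIntegrable
      (hφ.fderiv_apply_const v).continuous (hψ i hi).locallyIntegrable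

/-- Chain rule for a bounded Lipschitz function which is differentiable at almost all values that
are taken outside the critical set. -/
theorem IsWeakDeriv.integral_fderiv_smul_comp [CompleteSpace E] {v : Plane} {w W : Plane → E}
    (h : IsWeakDeriv v w W) (hw : Integrable w) (hW : Integrable W) {f : E → ℝ} {K : ℝ≥0}
    (hf : LipschitzWith K f) {B : ℝ} (hB : ∀ y, |f y| ≤ B) {φ : Plane → ℝ}
    (hφ : ContDiff ℝ ∞ φ) (hc : HasCompactSupport φ)
    (hdiff : ∀ᵐ x, φ x = 0 ∨ W x = 0 ∨ DifferentiableAt ℝ f (w x)) :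
    ∫ x, fderiv ℝ φ x v * f (w x) = -∫ x, φ x * fderiv ℝ f (w x) (W x) := by
  obtain ⟨M, hM⟩ := hc.exists_bound_of_continuous hφ.continuous
  have hfw : AEStronglyMeasurable (fun x => f (w x)) volume :=
    hf.continuous.comp_aestronglyMeasurable hw.1
  have hloc : LocallyIntegrable (fun x => f (w x)) :=
    (memLp_top_of_bound hfw B (Eventually.of_forall fun x => hB _)).locallyIntegrable le_top
  have hshift : ∀ y : Plane, MeasurePreserving (fun x => y + x) (volume : Measure Plane) volume :=
    fun y => measurePreserving_add_left volume y
  have D1 := (hasDerivAt_integral_smul_translate hφ hc hloc v 0).tendsto_slope_zero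
  simp only [zero_add, zero_smul, smul_eq_mul] at D1
  have iloc : ∀ t : ℝ, Integrable (fun x => φ x * f (w (t • v + x))) := fun t => by
    have hm : LocallyIntegrable (fun x => f (w (t • v + x))) :=
      (memLp_top_of_bound (hfw.comp_measurePreserving (hshift (t • v))) B
        (Eventually.of_forall fun x => hB _)).locallyIntegrable le_top
    exact hc.smul_locallyIntegrable hφ.continuous hm
  -- Discrete integration by parts: moving the difference quotient from f ∘ w to φ gives the
  -- left-hand side in the limit.
  have D2 : Tendsto (fun t : ℝ => ∫ x, φ x * (t⁻¹ * (f (w (t • v + x)) - f (w x)))) (𝓝[≠] 0)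
      (𝓝 (-∫ x, fderiv ℝ φ x v * f (w x))) := by
    refine D1.congr fun t => ?_
    have := iloc 0
    simp only [zero_smul, zero_add] at this
    rw [← integral_sub (iloc t) this, ← integral_const_mul]
    refine integral_congr_ae (Eventually.of_forall fun x => ?_)
    ring
  have meas_a : ∀ t : ℝ, AEStronglyMeasurable
      (fun x => φ x * (t⁻¹ * (f (w x + t • W x) - f (w x)))) volume := fun t =>
    hφ.continuous.aestronglyMeasurable.mul (((hf.continuous.comp_aestronglyMeasurable
      (hw.1.add (hW.1.const_smul t))).sub hfw).const_mul _)
  have bound_a : ∀ t : ℝ, t ≠ 0 → ∀ x,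
      ‖φ x * (t⁻¹ * (f (w x + t • W x) - f (w x)))‖ ≤ M * (K * ‖W x‖) := by
    intro t ht x
    rw [norm_mul]
    refine mul_le_mul (hM x) ?_ (norm_nonneg _) ((norm_nonneg _).trans (hM x))
    have := hf.norm_sub_le (w x + t • W x) (w x)
    rw [add_sub_cancel_left, norm_smul] at this
    rw [norm_mul, norm_inv]
    calc ‖t‖⁻¹ * ‖f (w x + t • W x) - f (w x)‖ ≤ ‖t‖⁻¹ * (K * (‖t‖ * ‖W x‖)) := by gcongr
      _ = K * ‖W x‖ := by field_simp
  have D3 : Tendsto (fun t : ℝ => ∫ x, φ x * (t⁻¹ * (f (w x + t • W x) - f (w x)))) (𝓝[≠] 0)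
      (𝓝 (∫ x, φ x * fderiv ℝ f (w x) (W x))) := by
    refine tendsto_integral_filter_of_dominated_convergence (fun x => M * (K * ‖W x‖))
      (Eventually.of_forall meas_a) ?_ ((hW.norm.const_mul _).const_mul _) ?_
    · filter_upwards [self_mem_nhdsWithin] with t ht
      exact Eventually.of_forall (bound_a t ht)
    -- Where φ or W vanishes, the integrand is zero for every t, so differentiability of f is needed
    -- only elsewhere.
    · filter_upwards [hdiff] with x hx
      rcases hx with hx | hx | hx
      · simp [hx]
      · simp [hx]
      · refine Tendsto.const_mul _ ?_
        have h1 : HasDerivAt (fun t : ℝ => w x + t • W x) (W x) 0 := by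
          simpa using ((hasDerivAt_id (0 : ℝ)).smul_const (W x)).const_add (w x)
        have h2 : HasFDerivAt f (fderiv ℝ f (w x)) (w x + (0 : ℝ) • W x) := by
          simpa using hx.hasFDerivAt
        have h3 := (h2.comp_hasDerivAt 0 h1).tendsto_slope_zero
        simpa [Function.comp_def] using h3
  -- The Lipschitz bound controls the replacement of w(x + tv) by w(x) + tW(x), after division by t,
  -- by K times the error of the difference quotient, which tends to 0 in L¹.
  have D4 : Tendsto (fun t : ℝ => (∫ x, φ x * (t⁻¹ * (f (w (t • v + x)) - f (w x))))
      - ∫ x, φ x * (t⁻¹ * (f (w x + t • W x) - f (w x)))) (𝓝[≠] 0) (𝓝 0) := by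
    have h0 := (h.tendsto_integral_norm_slope hw hW).const_mul (M * K)
    rw [mul_zero] at h0
    refine squeeze_zero_norm' ?_ h0
    filter_upwards [self_mem_nhdsWithin] with t ht
    have ht : t ≠ 0 := ht
    have hit : Integrable (fun x => t⁻¹ • (w (t • v + x) - w x) - W x) :=
      ((((hshift (t • v)).integrable_comp_of_integrable hw).sub hw).smul _).sub hW
    have i1 : Integrable (fun x => φ x * (t⁻¹ * (f (w (t • v + x)) - f (w x)))) := by
      have := iloc 0
      simp only [zero_smul, zero_add] at this
      refine (((iloc t).sub this).const_mul t⁻¹).congr (Eventually.of_forall fun x => ?_)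
      simp only [Pi.sub_apply]
      ring
    have i2 : Integrable (fun x => φ x * (t⁻¹ * (f (w x + t • W x) - f (w x)))) :=
      Integrable.mono' ((hW.norm.const_mul K).const_mul M) (meas_a t)
        (Eventually.of_forall (bound_a t ht))
    rw [← integral_sub i1 i2, ← integral_const_mul]
    refine norm_integral_le_of_norm_le (hit.norm.const_mul _) (Eventually.of_forall fun x => ?_)
    have h1 := hf.norm_sub_le (w (t • v + x)) (w x + t • W x)
    have h2 : w (t • v + x) - (w x + t • W x) = t • (t⁻¹ • (w (t • v + x) - w x) - W x) := by
      rw [smul_sub, smul_inv_smul₀ ht]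
      abel
    rw [h2, norm_smul] at h1
    have h3 : φ x * (t⁻¹ * (f (w (t • v + x)) - f (w x)))
        - φ x * (t⁻¹ * (f (w x + t • W x) - f (w x)))
        = φ x * (t⁻¹ * (f (w (t • v + x)) - f (w x + t • W x))) := by ring
    rw [h3, norm_mul, mul_assoc]
    refine mul_le_mul (hM x) ?_ (norm_nonneg _) ((norm_nonneg _).trans (hM x))
    rw [norm_mul, norm_inv]
    have htn : 0 < ‖t‖ := norm_pos_iff.2 ht
    rw [inv_mul_le_iff₀ htn]
    calc _ ≤ _ := h1
      _ = _ := by ring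
  have := tendsto_nhds_unique D2 (by simpa using D4.add D3)
  linarith

end ChainRule

/-! ### Bounded Lipschitz functions of a Sobolev map on `D`. -/

section Composition

theorem exists_isTest_one_near {D K : Set Plane} (hD : IsOpen D) (hK : IsCompact K) (hKD : K ⊆ D) :
    ∃ χ : Plane → ℝ, IsTest D χ ∧ ∀ x ∈ K, χ =ᶠ[𝓝 x] fun _ => 1 := by
  obtain ⟨K', hK', h1, h2⟩ := exists_compact_between hK hD hKD
  obtain ⟨χ, hχ1, hχ0, -⟩ := exists_contMDiffMap_one_nhds_of_subset_interior
    (n := (⊤ : ℕ∞)) (modelWithCornersSelf ℝ Plane) hK.isClosed h1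
  have hsub : tsupport χ ⊆ K' := by
    refine closure_minimal (fun x hx => ?_) hK'.isClosed
    by_contra h
    exact hx (hχ0 x h)
  refine ⟨χ, ⟨χ.contMDiff.contDiff, hK'.of_isClosed_subset (isClosed_tsupport _) hsub,
    hsub.trans h2⟩, fun x hx => ?_⟩
  exact (hχ1.filter_mono (nhds_le_nhdsSet hx))

theorem euclidean_eq_sum {n : ℕ} (y : EuclideanSpace ℝ (Fin n)) :
    y = ∑ k, y k • EuclideanSpace.single k (1 : ℝ) := by
  ext i
  simp [Finset.sum_apply, Pi.single_apply]

theorem abs_pderiv_le {n : ℕ} {f : EuclideanSpace ℝ (Fin n) → ℝ} {K : ℝ≥0} (hf : LipschitzWith K f)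
    (i : Fin n) (y : EuclideanSpace ℝ (Fin n)) : |pderiv i f y| ≤ K := by
  have := (fderiv ℝ f y).le_of_opNorm_le (norm_fderiv_le_of_lipschitz ℝ hf)
    (EuclideanSpace.single i 1)
  simpa [pderiv] using this

theorem measurable_pderiv {n : ℕ} (f : EuclideanSpace ℝ (Fin n) → ℝ) (i : Fin n) :
    Measurable (pderiv i f) :=
  measurable_fderiv_apply_const ℝ f _

theorem aestronglyMeasurable_of_coord {n : ℕ} {S : Set Plane}
    {u : Plane → EuclideanSpace ℝ (Fin n)}
    (hu : ∀ k, AEStronglyMeasurable (fun x => u x k) (volume.restrict S)) :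
    AEStronglyMeasurable u (volume.restrict S) := by
  rw [show u = fun x => ∑ k, u x k • EuclideanSpace.single k (1 : ℝ) from
    funext fun x => euclidean_eq_sum (u x)]
  exact Finset.aestronglyMeasurable_fun_sum _ fun k _ => (hu k).smul_const _

theorem memLp_top_pderiv_comp {n : ℕ} {S : Set Plane} {u : Plane → EuclideanSpace ℝ (Fin n)}
    (hu : AEStronglyMeasurable u (volume.restrict S)) {f : EuclideanSpace ℝ (Fin n) → ℝ}
    (hf : MemW1inf f) (i : Fin n) : MemLp (fun x => pderiv i f (u x)) ⊤ (volume.restrict S) := by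
  obtain ⟨K, hK⟩ := hf.1
  exact memLp_top_of_bound
    ((measurable_pderiv f i).comp_aemeasurable hu.aemeasurable).aestronglyMeasurable K
    (Eventually.of_forall fun x => abs_pderiv_le hK i (u x))

theorem memLp_top_comp {n : ℕ} {S : Set Plane} {u : Plane → EuclideanSpace ℝ (Fin n)}
    (hu : AEStronglyMeasurable u (volume.restrict S)) {f : EuclideanSpace ℝ (Fin n) → ℝ}
    (hf : MemW1inf f) : MemLp (fun x => f (u x)) ⊤ (volume.restrict S) := by
  obtain ⟨K, hK⟩ := hf.1
  obtain ⟨C, hC⟩ := hf.2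
  exact memLp_top_of_bound (hK.continuous.comp_aestronglyMeasurable hu) C
    (Eventually.of_forall fun x => hC (u x))

/-- Chain rule in `W^{1,2}` for a `W^{1,∞}` function of a vector-valued Sobolev map. -/
theorem hasW12Grad_comp {n : ℕ} {D : Set Plane} (hD : IsOpen D) (hDfin : volume D < ⊤)
    {u : Plane → EuclideanSpace ℝ (Fin n)} {du : Fin n → Plane → Plane}
    (hu : ∀ k, HasW12Grad D (fun x => u x k) (du k))
    {f : EuclideanSpace ℝ (Fin n) → ℝ} (hf : MemW1inf f)
    (hdiff : ∀ᵐ x ∂(volume.restrict D), (∀ k, du k x = 0) ∨ DifferentiableAt ℝ f (u x)) :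
    HasW12Grad D (fun x => f (u x)) (fun x => ∑ k, pderiv k f (u x) • du k x) := by
  have hfin : IsFiniteMeasure (volume.restrict D) := ⟨by simpa using hDfin⟩
  have hum : AEStronglyMeasurable u (volume.restrict D) :=
    aestronglyMeasurable_of_coord fun k => (hu k).1.1
  have m1 : MemLp (fun x => f (u x)) 2 (volume.restrict D) :=
    (memLp_top_comp hum hf).mono_exponent le_top
  have m2 : MemLp (fun x => ∑ k, pderiv k f (u x) • du k x) 2 (volume.restrict D) :=
    memLp_finsetSum _ fun k _ => (hu k).2.1.smul (memLp_top_pderiv_comp hum hf k)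
  refine ⟨m1, m2, (isWeakGrad_iff (m1.integrable (by norm_num))
    (m2.integrable (by norm_num))).2 fun φ hφ v => ?_⟩
  obtain ⟨K, hK⟩ := hf.1
  obtain ⟨B, hB⟩ := hf.2
  -- The map χu lives on the whole plane, as the difference quotient argument requires. Since χ = 1
  -- near the support of φ, both χu and its weak derivative agree there with those of u.
  obtain ⟨χ, hχ, hχ1⟩ := exists_isTest_one_near hD hφ.2.1 hφ.2.2
  set w : Plane → EuclideanSpace ℝ (Fin n) := fun x =>
    ∑ k, (χ x * u x k) • EuclideanSpace.single k (1 : ℝ) with hw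
  set W : Plane → EuclideanSpace ℝ (Fin n) := fun x =>
    ∑ k, (χ x * inner ℝ v (du k x) + fderiv ℝ χ x v * u x k) • EuclideanSpace.single k (1 : ℝ)
    with hW
  have hui := fun k => (hu k).integrableOn hDfin
  have iw : ∀ k ∈ Finset.univ, Integrable
      (fun x => (χ x * u x k) • EuclideanSpace.single (𝕜 := ℝ) k (1 : ℝ)) := fun k _ =>
    (hχ.integrable_mul_of_integrableOn (hui k).1).smul_const _
  have iW : ∀ k ∈ Finset.univ, Integrable
      (fun x => (χ x * inner ℝ v (du k x) + fderiv ℝ χ x v * u x k) •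
        EuclideanSpace.single (𝕜 := ℝ) k (1 : ℝ)) := fun k _ =>
    ((hχ.integrable_mul_of_integrableOn ((hui k).2.const_inner v)).add
      ((hχ.fderiv_apply v).integrable_mul_of_integrableOn (hui k).1)).smul_const _
  have hwW : IsWeakDeriv v w W :=
    IsWeakDeriv.sum (fun k _ => ((hu k).isWeakDeriv_mul hDfin hχ v).smul_const _) iw iW
  have hweq : ∀ x ∈ tsupport φ, w x = u x := fun x hx => by
    simp only [hw, (hχ1 x hx).self_of_nhds, one_mul]
    exact (euclidean_eq_sum (u x)).symm
  have hWeq : ∀ x ∈ tsupport φ, W x =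
      ∑ k, inner ℝ v (du k x) • EuclideanSpace.single k (1 : ℝ) := fun x hx => by
    simp [hW, (hχ1 x hx).self_of_nhds, (hχ1 x hx).fderiv_eq]
  have hdiff' : ∀ᵐ x, φ x = 0 ∨ W x = 0 ∨ DifferentiableAt ℝ f (w x) := by
    filter_upwards [(ae_restrict_iff' hD.measurableSet).1 hdiff] with x hx
    by_cases hxs : x ∈ tsupport φ
    · right
      rw [hweq x hxs, hWeq x hxs]
      exact (hx (hφ.2.2 hxs)).imp (fun h => by simp [h]) id
    · exact Or.inl (image_eq_zero_of_notMem_tsupport hxs)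
  have key := hwW.integral_fderiv_smul_comp (integrable_finsetSum _ iw)
    (integrable_finsetSum _ iW) hK hB hφ.1 hφ.2.1 hdiff'
  rw [(hφ.fderiv_apply v).setIntegral_mul, hφ.setIntegral_mul]
  have e1 : ∀ x, fderiv ℝ φ x v * f (u x) = fderiv ℝ φ x v * f (w x) := fun x => by
    by_cases hxs : x ∈ tsupport φ
    · rw [hweq x hxs]
    · rw [image_eq_zero_of_notMem_tsupport fun h =>
        hxs (tsupport_fderiv_apply_subset ℝ v h), zero_mul, zero_mul]
  have e2 : ∀ x, φ x * inner ℝ v (∑ k, pderiv k f (u x) • du k x)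
      = φ x * fderiv ℝ f (w x) (W x) := fun x => by
    by_cases hxs : x ∈ tsupport φ
    · rw [hweq x hxs, hWeq x hxs, map_sum, inner_sum]
      simp only [map_smul, smul_eq_mul, inner_smul_right, pderiv, mul_comm]
    · rw [image_eq_zero_of_notMem_tsupport hxs, zero_mul, zero_mul]
  simp only [e1, e2]
  exact key

end Composition

/-! ### Enlarging the class of test functions; products with bounded Sobolev functions. -/

section ProductRule

/-- The translate t ↦ ρ(x - t) is itself a test function, so the derivative passes from ρ to ψ. -/
theorem fderiv_convolution_of_isWeakDeriv {v : Plane} {ψ Ψ : Plane → ℝ} (h : IsWeakDeriv v ψ Ψ)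
    (hψ : LocallyIntegrable ψ) {ρ : Plane → ℝ} (hρ : ContDiff ℝ ∞ ρ) (hc : HasCompactSupport ρ)
    (x : Plane) :
    fderiv ℝ (ρ ⋆[ContinuousLinearMap.lsmul ℝ ℝ] ψ) x v = ∫ t, ρ t * Ψ (x - t) := by
  set L := ContinuousLinearMap.lsmul ℝ ℝ (E := ℝ)
  have hd : DifferentiableAt ℝ (ρ ⋆[L] ψ) x :=
    (hc.contDiff_convolution_left L hρ hψ).differentiable (by simp) x
  have h1 : HasDerivAt (fun s : ℝ => x + s • v) v 0 := by
    simpa using ((hasDerivAt_id (0 : ℝ)).smul_const v).const_add x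
  have h2 : HasFDerivAt (ρ ⋆[L] ψ) (fderiv ℝ (ρ ⋆[L] ψ) x) (x + (0 : ℝ) • v) := by
    simpa using hd.hasFDerivAt
  have h3 := h2.comp_hasDerivAt 0 h1
  have hρ' : ContDiff ℝ ∞ (fun t => ρ (x - t)) := hρ.comp (contDiff_const.sub contDiff_id)
  have hc' : HasCompactSupport (fun t => ρ (x - t)) :=
    hc.comp_homeomorph (Homeomorph.subLeft x)
  have h4 := hasDerivAt_integral_smul_translate hρ' hc' hψ v 0
  have e1 : (ρ ⋆[L] ψ) ∘ (fun s : ℝ => x + s • v)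
      = fun s : ℝ => ∫ t, ρ (x - t) • ψ (s • v + t) := by
    ext s
    rw [Function.comp_apply, convolution_def,
      ← integral_sub_left_eq_self (fun t => L (ρ t) (ψ (x + s • v - t))) volume x]
    refine integral_congr_ae (Eventually.of_forall fun t => ?_)
    simp only [L, ContinuousLinearMap.lsmul_apply]
    congr 2
    abel
  rw [e1] at h3
  rw [h3.unique h4]
  simp only [zero_smul, zero_add]
  rw [h _ hρ' hc', neg_neg, ← integral_sub_left_eq_self (fun t => ρ t * Ψ (x - t)) volume x]
  simp

/-- Translations act continuously on L². Evaluated at t = 0, this identifies the limit of the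
mollified pairings. -/
theorem continuous_integral_inner_translate {X Ψ : Plane → Plane} (hX : MemLp X 2)
    (hΨ : MemLp Ψ 2) : Continuous fun t : Plane => ∫ x, inner ℝ (X x) (Ψ (t + x)) := by
  have : Fact ((2 : ℝ≥0∞) ≠ ⊤) := ⟨by norm_num⟩
  have h1 : Continuous fun t : Plane =>
      inner ℝ (hX.toLp X) ((DomAddAct.mk t : Planeᵈᵃᵃ) +ᵥ hΨ.toLp Ψ) :=
    continuous_const.inner (DomAddAct.continuous_mk.vadd continuous_const)
  refine h1.congr fun t => ?_
  rw [L2.inner_def, DomAddAct.mk_vadd_toLp]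
  refine integral_congr_ae ?_
  filter_upwards [hX.coeFn_toLp,
    (hΨ.comp_measurePreserving (measurePreserving_vadd t volume)).coeFn_toLp] with x h1 h2
  rw [h1]
  exact congrArg _ h2

/-- Fubini, with the integrable majorant |ρ|(|X|² + |Ψ|²) for |ρ||X||Ψ|. -/
theorem integral_integral_inner_translate {X Ψ : Plane → Plane} (hX : MemLp X 2)
    (hΨ : MemLp Ψ 2) {ρ : Plane → ℝ} (hρ : Integrable ρ) :
    ∫ x, ∫ t, ρ t * inner ℝ (X x) (Ψ (x - t)) = ∫ t, ρ t * ∫ x, inner ℝ (X x) (Ψ (x - t)) := by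
  rw [integral_integral_swap]
  · simp only [integral_const_mul]
  have hX2 : Integrable (fun x => ‖X x‖ ^ 2) := hX.integrable_norm_pow (by norm_num)
  have hΨ2 : Integrable (fun x => ‖Ψ x‖ ^ 2) := hΨ.integrable_norm_pow (by norm_num)
  have i1 : Integrable (fun p : Plane × Plane => ‖X p.1‖ ^ 2 * ‖ρ p.2‖) (volume.prod volume) :=
    hX2.mul_prod hρ.norm
  have i2 : Integrable (fun p : Plane × Plane => ‖ρ p.2‖ * ‖Ψ (p.1 - p.2)‖ ^ 2)
      (volume.prod volume) :=
    hρ.norm.convolution_integrand (ContinuousLinearMap.mul ℝ ℝ) hΨ2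
  refine (i1.add i2).mono' ?_ (Eventually.of_forall fun p => ?_)
  · exact hρ.1.comp_snd.mul (hX.1.comp_fst.inner
      (hΨ.1.comp_quasiMeasurePreserving (quasiMeasurePreserving_sub_of_right_invariant _ _)))
  · simp only [Function.uncurry, Pi.add_apply]
    rw [norm_mul]
    have h1 := norm_inner_le_norm (𝕜 := ℝ) (X p.1) (Ψ (p.1 - p.2))
    have h2 := norm_nonneg (ρ p.2)
    nlinarith [sq_nonneg (‖X p.1‖ - ‖Ψ (p.1 - p.2)‖), sq_nonneg ‖X p.1‖,
      sq_nonneg ‖Ψ (p.1 - p.2)‖, mul_le_mul_of_nonneg_left h1 h2,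
      mul_nonneg h2 (sq_nonneg (‖X p.1‖ - ‖Ψ (p.1 - p.2)‖)), mul_nonneg h2 (sq_nonneg ‖X p.1‖),
      mul_nonneg h2 (sq_nonneg ‖Ψ (p.1 - p.2)‖)]

theorem integrableOn_inner {S : Set Plane} {X Y : Plane → Plane}
    (hX : MemLp X 2 (volume.restrict S)) (hY : MemLp Y 2 (volume.restrict S)) :
    IntegrableOn (fun x => inner ℝ (X x) (Y x)) S :=
  (hX.norm.integrable_mul hY.norm).mono' (hX.1.inner hY.1)
    (Eventually.of_forall fun _ => norm_inner_le_norm _ _)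

/-- Radii at most δ keep mollified supports inside `D`; the bounded ratio of outer to inner radius
gives almost everywhere convergence of mollifications of locally integrable functions. -/
theorem exists_contDiffBump_seq {δ : ℝ} (hδ : 0 < δ) :
    ∃ ρ : ℕ → ContDiffBump (0 : Plane), (∀ i, (ρ i).rOut ≤ δ) ∧
      Tendsto (fun i => (ρ i).rOut) atTop (𝓝 0) ∧ ∀ i, (ρ i).rOut ≤ 2 * (ρ i).rIn := by
  have hpos : ∀ i : ℕ, 0 < δ / (i + 1 : ℝ) := fun i => by positivity
  refine ⟨fun i => ⟨δ / (i + 1) / 2, δ / (i + 1), half_pos (hpos i), half_lt_self (hpos i)⟩,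
    fun i => ?_, ?_, fun i => ?_⟩
  · exact div_le_self hδ.le (by simp)
  · simpa [div_eq_mul_inv] using (tendsto_one_div_add_atTop_nhds_zero_nat (𝕜 := ℝ)).const_mul δ
  · change δ / (i + 1 : ℝ) ≤ 2 * (δ / (i + 1) / 2)
    linarith

theorem norm_convolution_bump_le {ψ : Plane → ℝ} {B : ℝ} (hB : ∀ x, |ψ x| ≤ B)
    (ρ : ContDiffBump (0 : Plane)) (x : Plane) :
    ‖((ρ.normed volume) ⋆[ContinuousLinearMap.lsmul ℝ ℝ] ψ) x‖ ≤ B := by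
  have h := norm_integral_le_of_norm_le (f := fun t => ρ.normed volume t • ψ (x - t))
    (g := fun t => ρ.normed volume t * B) (μ := volume) (ρ.integrable_normed.mul_const B)
    (Eventually.of_forall fun t => by
      rw [norm_smul, Real.norm_of_nonneg (ρ.nonneg_normed t)]
      exact mul_le_mul_of_nonneg_left (hB _) (ρ.nonneg_normed t))
  rwa [integral_mul_const, ρ.integral_normed, one_mul] at h

/-- Weak divergences may be tested with bounded compactly supported functions having a square
integrable weak gradient. -/
theorem IsWeakDiv.integral_inner_weakGrad {D K : Set Plane} (hD : IsOpen D)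
    {X : Plane → Plane} {f : Plane → ℝ} (h : IsWeakDiv D X f)
    (hX : MemLp X 2 (volume.restrict D)) (hf : IntegrableOn f D)
    (hK : IsCompact K) (hKD : K ⊆ D) {ψ : Plane → ℝ} {Ψ : Plane → Plane}
    (hψK : ∀ x ∉ K, ψ x = 0) (hψ : Integrable ψ) {B : ℝ} (hB : ∀ x, |ψ x| ≤ B)
    (hΨ : MemLp Ψ 2) (hweak : ∀ v, IsWeakDeriv v ψ (fun x => inner ℝ v (Ψ x))) :
    ∫ x in D, inner ℝ (X x) (Ψ x) = -∫ x in D, f x * ψ x := by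
  have hDm := hD.measurableSet
  set L := ContinuousLinearMap.lsmul ℝ ℝ (E := ℝ)
  set X' := D.indicator X with hX'
  have hX'2 : MemLp X' 2 := (memLp_indicator_iff_restrict hDm).2 hX
  obtain ⟨δ, hδ, hδD⟩ := hK.exists_cthickening_subset_open hD hKD
  obtain ⟨ρ, hρδ, hρ0, hρK⟩ := exists_contDiffBump_seq hδ
  set η : ℕ → Plane → ℝ := fun i => (ρ i).normed volume ⋆[L] ψ with hη
  have hηs : ∀ i, ContDiff ℝ ∞ (η i) := fun i =>
    (ρ i).hasCompactSupport_normed.contDiff_convolution_left L (ρ i).contDiff_normed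
      hψ.locallyIntegrable
  have hsupp : ∀ i, tsupport (η i) ⊆ Metric.cthickening δ K := fun i => by
    refine closure_minimal ?_ Metric.isClosed_cthickening
    intro x hx
    obtain ⟨b, hb, a, ha, rfl⟩ := support_convolution_subset_swap L hx
    have hbK : b ∈ K := by
      by_contra hb'
      exact hb (hψK b hb')
    rw [(ρ i).support_normed_eq] at ha
    refine Metric.mem_cthickening_of_dist_le _ b δ K hbK ?_
    have : ‖a‖ < (ρ i).rOut := by simpa using ha
    simpa [dist_eq_norm] using (this.le.trans (hρδ i))
  have hηt : ∀ i, IsTest D (η i) := fun i =>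
    ⟨hηs i, hK.cthickening.of_isClosed_subset (isClosed_tsupport _) (hsupp i),
      (hsupp i).trans hδD⟩
  -- Pairing X with the gradient of a mollification equals mollifying the correlation of X and Ψ and
  -- evaluating at 0; X is extended by zero outside `D`.
  have e1 : ∀ i, ∫ x in D, inner ℝ (X x) (gradient (η i) x)
      = ((ρ i).normed volume ⋆[L] fun t => ∫ x, inner ℝ (X' x) (Ψ (t + x))) 0 := by
    intro i
    rw [← integral_indicator hDm]
    have : ∀ x, D.indicator (fun x => inner ℝ (X x) (gradient (η i) x)) x
        = ∫ t, (ρ i).normed volume t * inner ℝ (X' x) (Ψ (x - t)) := fun x => by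
      rw [← fderiv_convolution_of_isWeakDeriv (hweak (X' x)) hψ.locallyIntegrable
        (ρ i).contDiff_normed (ρ i).hasCompactSupport_normed, ← inner_gradient]
      by_cases hx : x ∈ D
      · simp [hX', hx, hη, L]
      · simp [hX', hx]
    simp only [this]
    rw [integral_integral_inner_translate hX'2 hΨ (ρ i).integrable_normed, convolution_def]
    simp [L, sub_eq_neg_add]
  have l1 : Tendsto (fun i => ∫ x in D, inner ℝ (X x) (gradient (η i) x)) atTop
      (𝓝 (∫ x in D, inner ℝ (X x) (Ψ x))) := by
    have := ContDiffBump.convolution_tendsto_right_of_continuous (μ := volume) hρ0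
      (continuous_integral_inner_translate hX'2 hΨ) 0
    simp only [e1]
    convert this using 2
    rw [← integral_indicator hDm]
    refine integral_congr_ae (Eventually.of_forall fun x => ?_)
    by_cases hx : x ∈ D <;> simp [hX', hx]
  -- Here f is only integrable, so the uniform bound on ψ is essential: mollification preserves it,
  -- and |f|B dominates.
  have l2 : Tendsto (fun i => ∫ x in D, f x * η i x) atTop (𝓝 (∫ x in D, f x * ψ x)) := by
    refine tendsto_integral_of_dominated_convergence (fun x => ‖f x‖ * B)
      (fun i => hf.1.mul (hηs i).continuous.aestronglyMeasurable) (hf.norm.mul_const B)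
      (fun i => Eventually.of_forall fun x => ?_) ?_
    · rw [norm_mul]
      exact mul_le_mul_of_nonneg_left (norm_convolution_bump_le hB (ρ i) x) (norm_nonneg _)
    · filter_upwards [ae_restrict_of_ae
        (ContDiffBump.ae_convolution_tendsto_right_of_locallyIntegrable hρ0
          (Eventually.of_forall hρK) hψ.locallyIntegrable)] with x hx
      exact hx.const_mul _
  refine tendsto_nhds_unique l1 ?_
  simp only [fun i => h.2.2 (η i) (hηt i)]
  exact l2.neg

/-- Product rule for the weak divergence of a square integrable field multiplied by a bounded
Sobolev function. -/
theorem IsWeakDiv.mul {D : Set Plane} (hD : IsOpen D) (hDfin : volume D < ⊤)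
    {X : Plane → Plane} {f : Plane → ℝ} (h : IsWeakDiv D X f)
    (hX : MemLp X 2 (volume.restrict D)) (hf : IntegrableOn f D)
    {α : Plane → ℝ} {F : Plane → Plane} (hα : HasW12Grad D α F) {B : ℝ} (hB : ∀ x, |α x| ≤ B) :
    IsWeakDiv D (fun x => α x • X x) (fun x => α x * f x + inner ℝ (F x) (X x)) := by
  have hfin : IsFiniteMeasure (volume.restrict D) := ⟨by simpa using hDfin⟩
  have hαt : MemLp α ⊤ (volume.restrict D) :=
    memLp_top_of_bound hα.1.1 B (Eventually.of_forall hB)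
  have iαX : MemLp (fun x => α x • X x) 2 (volume.restrict D) := hX.smul hαt
  have iαf : IntegrableOn (fun x => α x * f x) D :=
    hf.bdd_mul (c := B) hα.1.1 (Eventually.of_forall hB)
  have iFX : IntegrableOn (fun x => inner ℝ (F x) (X x)) D := integrableOn_inner hα.2.1 hX
  refine ⟨IntegrableOn.locallyIntegrableOn (iαX.integrable (by norm_num)),
    (iαf.add iFX).locallyIntegrableOn, fun φ hφ => ?_⟩
  obtain ⟨C, hC⟩ := hφ.2.1.exists_bound_of_continuous hφ.1.continuous
  obtain ⟨C', hC'⟩ := hφ.exists_bound_gradient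
  have hφt : MemLp φ ⊤ (volume.restrict D) :=
    memLp_top_of_bound hφ.1.continuous.aestronglyMeasurable C (Eventually.of_forall hC)
  have hgt : MemLp (gradient φ) ⊤ (volume.restrict D) :=
    memLp_top_of_bound (continuous_gradient hφ.1).aestronglyMeasurable C' (Eventually.of_forall hC')
  -- The weak gradient of φα; it vanishes outside `D`, so it is square integrable on the whole
  -- plane.
  set Ψ : Plane → Plane := fun x => φ x • F x + α x • gradient φ x with hΨ
  have hΨ2 : MemLp Ψ 2 (volume.restrict D) :=
    (hα.2.1.smul hφt).add ((hgt.smul hαt).mono_exponent le_top)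
  have hΨ0 : ∀ x ∉ D, Ψ x = 0 := fun x hx => by
    have h1 : x ∉ tsupport φ := fun h => hx (hφ.2.2 h)
    have h2 : gradient φ x = 0 := by
      rw [gradient, image_eq_zero_of_notMem_tsupport fun h => h1 (tsupport_fderiv_subset ℝ h),
        map_zero]
    simp [hΨ, h2, hφ.apply_eq_zero hx]
  have hΨg : MemLp Ψ 2 := by
    rwa [← memLp_indicator_iff_restrict hD.measurableSet,
      Set.indicator_eq_self.2 (Function.support_subset_iff'.2 hΨ0)] at hΨ2
  have hweak : ∀ v, IsWeakDeriv v (fun x => φ x * α x) (fun x => inner ℝ v (Ψ x)) := fun v => by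
    convert hα.isWeakDeriv_mul hDfin hφ v using 2 with x
    simp only [hΨ, inner_add_right, inner_smul_right, inner_gradient]
    ring
  have key := h.integral_inner_weakGrad hD hX hf hφ.2.1 hφ.2.2
    (fun x hx => by rw [image_eq_zero_of_notMem_tsupport hx, zero_mul])
    (hφ.integrable_mul_of_integrableOn (hα.integrableOn hDfin).1) (B := C * B)
    (fun x => by
      rw [abs_mul]
      exact mul_le_mul (hC x) (hB x) (abs_nonneg _) ((norm_nonneg _).trans (hC x)))
    hΨg hweak
  have j1 : IntegrableOn (fun x => φ x * inner ℝ (F x) (X x)) D := hφ.integrable_mul iFX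
  have j2 : IntegrableOn (fun x => inner ℝ (α x • X x) (gradient φ x)) D :=
    integrableOn_inner iαX (hgt.mono_exponent le_top)
  have j3 : IntegrableOn (fun x => φ x * (α x * f x)) D := hφ.integrable_mul iαf
  have e1 : ∀ x, inner ℝ (X x) (Ψ x)
      = φ x * inner ℝ (F x) (X x) + inner ℝ (α x • X x) (gradient φ x) := fun x => by
    rw [hΨ, inner_add_right, inner_smul_right, inner_smul_right, real_inner_smul_left,
      real_inner_comm]
  have e2 : ∀ x, f x * (φ x * α x) = φ x * (α x * f x) := fun x => by ring
  have e3 : ∀ x, (α x * f x + inner ℝ (F x) (X x)) * φ x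
      = φ x * (α x * f x) + φ x * inner ℝ (F x) (X x) := fun x => by ring
  simp only [e1, e2] at key
  simp only [e3]
  rw [integral_add j1 j2] at key
  rw [integral_add j3 j1]
  linarith

theorem IsWeakDiv.sum {ι : Type*} (s : Finset ι) {D : Set Plane} {X : ι → Plane → Plane}
    {f : ι → Plane → ℝ} (h : ∀ i ∈ s, IsWeakDiv D (X i) (f i))
    (hX : ∀ i ∈ s, IntegrableOn (X i) D) (hf : ∀ i ∈ s, IntegrableOn (f i) D) :
    IsWeakDiv D (fun x => ∑ i ∈ s, X i x) (fun x => ∑ i ∈ s, f i x) := by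
  refine ⟨IntegrableOn.locallyIntegrableOn (integrable_finsetSum _ hX),
    IntegrableOn.locallyIntegrableOn (integrable_finsetSum _ hf), fun φ hφ => ?_⟩
  obtain ⟨C', hC'⟩ := hφ.exists_bound_gradient
  simp only [sum_inner, Finset.sum_mul]
  rw [integral_finsetSum, integral_finsetSum, ← Finset.sum_neg_distrib]
  · exact Finset.sum_congr rfl fun i hi => (h i hi).2.2 φ hφ
  · intro i hi
    exact (hφ.integrable_mul (hf i hi)).congr (Eventually.of_forall fun x => mul_comm _ _)
  · intro i hi
    refine ((hX i hi).norm.mul_const C').mono' ((hX i hi).1.inner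
      (continuous_gradient hφ.1).aestronglyMeasurable) (Eventually.of_forall fun x => ?_)
    exact (norm_inner_le_norm _ _).trans (mul_le_mul_of_nonneg_left (hC' x) (norm_nonneg _))

theorem IsWeakDiv.congr {D : Set Plane} {X X' : Plane → Plane} {f f' : Plane → ℝ}
    (h : IsWeakDiv D X f) (hX : X =ᵐ[volume.restrict D] X') (hf : f =ᵐ[volume.restrict D] f')
    (iX : IntegrableOn X D) (jf : IntegrableOn f D) : IsWeakDiv D X' f' := by
  refine ⟨IntegrableOn.locallyIntegrableOn (iX.congr hX),
    IntegrableOn.locallyIntegrableOn (jf.congr hf), fun φ hφ => ?_⟩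
  have e1 : ∫ x in D, inner ℝ (X' x) (gradient φ x) = ∫ x in D, inner ℝ (X x) (gradient φ x) :=
    integral_congr_ae (hX.mono fun x hx => by simp only [hx])
  have e2 : ∫ x in D, f' x * φ x = ∫ x in D, f x * φ x :=
    integral_congr_ae (hf.mono fun x hx => by simp only [hx])
  rw [e1, e2, h.2.2 φ hφ]

end ProductRule

/-! ### The positive square root of the metric: bounds, Lipschitz continuity, differentiability. -/

section SquareRoot

theorem MemW1inf.mul {n : ℕ} {f h : EuclideanSpace ℝ (Fin n) → ℝ} (hf : MemW1inf f)
    (hh : MemW1inf h) : MemW1inf (fun y => f y * h y) := by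
  obtain ⟨⟨K, hK⟩, C, hC⟩ := hf
  obtain ⟨⟨K', hK'⟩, C', hC'⟩ := hh
  have hC0 : 0 ≤ C := (abs_nonneg _).trans (hC 0)
  have hC'0 : 0 ≤ C' := (abs_nonneg _).trans (hC' 0)
  refine ⟨⟨C.toNNReal * K' + C'.toNNReal * K, LipschitzWith.of_dist_le_mul fun y z => ?_⟩,
    C * C', fun y => ?_⟩
  · have h1 := hK.dist_le_mul y z
    have h2 := hK'.dist_le_mul y z
    rw [Real.dist_eq] at h1 h2
    rw [Real.dist_eq, show f y * h y - f z * h z = f y * (h y - h z) + h z * (f y - f z) by ring]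
    refine (abs_add_le _ _).trans ?_
    rw [abs_mul, abs_mul]
    calc _ ≤ C * (K' * dist y z) + C' * (K * dist y z) := by
          gcongr
          · exact hC y
          · exact hC' z
      _ = _ := by
          simp only [NNReal.coe_add, NNReal.coe_mul, Real.coe_toNNReal C hC0,
            Real.coe_toNNReal C' hC'0]
          ring
  · rw [abs_mul]
    exact mul_le_mul (hC y) (hC' y) (abs_nonneg _) hC0

theorem MemW1inf.sum {n : ℕ} {ι : Type*} (s : Finset ι)
    {f : ι → EuclideanSpace ℝ (Fin n) → ℝ} (hf : ∀ i, MemW1inf (f i)) :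
    MemW1inf (fun y => ∑ i ∈ s, f i y) := by
  choose hK hC using hf
  choose K hK using hK
  choose C hC using hC
  refine ⟨⟨∑ i ∈ s, K i, LipschitzWith.of_dist_le_mul fun y z => ?_⟩, ∑ i ∈ s, C i, fun y =>
    (Finset.abs_sum_le_sum_abs _ _).trans (Finset.sum_le_sum fun i _ => hC i y)⟩
  rw [NNReal.coe_sum, Finset.sum_mul]
  exact (dist_sum_sum_le _ _ _).trans (Finset.sum_le_sum fun i _ => (hK i).dist_le_mul y z)

open Matrix

open scoped MatrixOrder in
theorem exists_posSemidef_sqrt {n : ℕ} {G : Matrix (Fin n) (Fin n) ℝ} (hG : G.PosDef) :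
    ∃ S : Matrix (Fin n) (Fin n) ℝ, S.PosSemidef ∧ S * S = G :=
  ⟨CFC.sqrt G, nonneg_iff_posSemidef.1 (CFC.sqrt_nonneg G),
    CFC.sqrt_mul_sqrt_self G hG.posSemidef.nonneg⟩

theorem dotProduct_mulVec_le {n : ℕ} {G : Matrix (Fin n) (Fin n) ℝ} {C : ℝ}
    (hC : ∀ i j, |G i j| ≤ C) (x : Fin n → ℝ) : x ⬝ᵥ (G *ᵥ x) ≤ n * C * (x ⬝ᵥ x) := by
  have h1 : x ⬝ᵥ (G *ᵥ x) = ∑ i, ∑ j, x i * (G i j * x j) := by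
    simp only [dotProduct, mulVec, Finset.mul_sum]
  have h2 : n * C * (x ⬝ᵥ x) = ∑ i : Fin n, ∑ j : Fin n, C * ((x i ^ 2 + x j ^ 2) / 2) := by
    simp only [← Finset.mul_sum, ← Finset.sum_div, Finset.sum_add_distrib, Finset.sum_const,
      Finset.card_univ, Fintype.card_fin, nsmul_eq_mul, dotProduct, ← pow_two]
    ring
  rw [h1, h2]
  refine Finset.sum_le_sum fun i _ => Finset.sum_le_sum fun j _ => ?_
  have h3 := hC i j
  have h4 : |x i| * |x j| ≤ (x i ^ 2 + x j ^ 2) / 2 := by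
    nlinarith [sq_nonneg (|x i| - |x j|), sq_abs (x i), sq_abs (x j)]
  calc x i * (G i j * x j) ≤ |x i * (G i j * x j)| := le_abs_self _
    _ = |G i j| * (|x i| * |x j|) := by rw [abs_mul, abs_mul]; ring
    _ ≤ _ := mul_le_mul h3 h4 (by positivity) ((abs_nonneg _).trans h3)

/-- A lower bound for the square root in terms of a bound for the inverse. -/
theorem le_dotProduct_sqrt_mulVec {n : ℕ} {G S : Matrix (Fin n) (Fin n) ℝ} (hG : G.PosDef)
    (hS : S.PosSemidef) (hSG : S * S = G) {C : ℝ} (hC0 : 0 ≤ C) (hC : ∀ i j, |G⁻¹ i j| ≤ C)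
    (x : Fin n → ℝ) : (1 + n * C)⁻¹ * (x ⬝ᵥ x) ≤ x ⬝ᵥ (S *ᵥ x) := by
  set κ : ℝ := 1 + n * C with hκ
  have hκ1 : 1 ≤ κ := by
    have : 0 ≤ n * C := by positivity
    linarith
  have hκ0 : 0 < κ := by linarith
  have hdet : IsUnit S.det := by
    have h1 : IsUnit (S * S).det := (isUnit_iff_isUnit_det _).1 (hSG ▸ hG.isUnit)
    rw [det_mul] at h1
    exact isUnit_of_mul_isUnit_left h1
  have hsym : Sᵀ = S := by simpa using hS.1.eq
  have hisym : (S⁻¹)ᵀ = S⁻¹ := by rw [transpose_nonsing_inv, hsym]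
  set r := S⁻¹ *ᵥ x with hr
  have hSr : S *ᵥ r = x := by rw [hr, mulVec_mulVec, mul_nonsing_inv _ hdet, one_mulVec]
  have hxS : ∀ y, (S *ᵥ y) ⬝ᵥ r = y ⬝ᵥ x := fun y => by
    rw [← hSr, dotProduct_comm, dotProduct_mulVec, ← mulVec_transpose, hsym, hSr, dotProduct_comm]
  have hrr : r ⬝ᵥ r ≤ n * C * (x ⬝ᵥ x) := by
    have h1 : r ⬝ᵥ r = x ⬝ᵥ (G⁻¹ *ᵥ x) := by
      rw [← hSG, Matrix.mul_inv_rev, ← mulVec_mulVec, dotProduct_mulVec x, ← mulVec_transpose, hisym]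
    rw [h1]
    exact dotProduct_mulVec_le hC x
  have hxr : x ⬝ᵥ r ≤ κ * (x ⬝ᵥ x) := by
    have h1 : 0 ≤ (x - r) ⬝ᵥ (x - r) := by
      simpa using dotProduct_star_self_nonneg (x - r)
    have h2 : 0 ≤ x ⬝ᵥ x := by simpa using dotProduct_star_self_nonneg x
    simp only [sub_dotProduct, dotProduct_sub, dotProduct_comm r x] at h1
    nlinarith [mul_nonneg (mul_nonneg (Nat.cast_nonneg (α := ℝ) n) hC0) h2]
  -- With r = S⁻¹x and |r|² = x·G⁻¹x ≤ nC|x|², one has x·r ≤ κ|x|². Positivity of S on x - κ⁻¹r,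
  -- expanded with Sr = x, then yields the lower bound κ⁻¹|x|² without spectral theory. The summand
  -- 1 in κ keeps it positive.
  have hpos : 0 ≤ (x - κ⁻¹ • r) ⬝ᵥ (S *ᵥ (x - κ⁻¹ • r)) := by
    simpa using hS.dotProduct_mulVec_nonneg (x - κ⁻¹ • r)
  have hexp : (x - κ⁻¹ • r) ⬝ᵥ (S *ᵥ (x - κ⁻¹ • r))
      = x ⬝ᵥ (S *ᵥ x) - 2 * κ⁻¹ * (x ⬝ᵥ x) + κ⁻¹ * κ⁻¹ * (x ⬝ᵥ r) := by
    rw [mulVec_sub, mulVec_smul, hSr]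
    simp only [sub_dotProduct, dotProduct_sub, smul_dotProduct, dotProduct_smul, smul_eq_mul,
      dotProduct_comm r (S *ᵥ x), hxS x, dotProduct_comm r x]
    ring
  rw [hexp] at hpos
  have h5 : κ⁻¹ * κ⁻¹ * (x ⬝ᵥ r) ≤ κ⁻¹ * (x ⬝ᵥ x) := by
    calc κ⁻¹ * κ⁻¹ * (x ⬝ᵥ r) ≤ κ⁻¹ * κ⁻¹ * (κ * (x ⬝ᵥ x)) := by gcongr
      _ = _ := by field_simp
  linarith

-- The Frobenius norm is submultiplicative, as the quadratic remainder below requires, and Euclidean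
-- in the entries, as the Cauchy–Schwarz argument for the Sylvester operator requires.
attribute [local instance] Matrix.frobeniusNormedRing Matrix.frobeniusNormedAlgebra

theorem frobenius_norm_sq {n : ℕ} (X : Matrix (Fin n) (Fin n) ℝ) :
    ‖X‖ ^ 2 = ∑ p : Fin n × Fin n, X p.1 p.2 ^ 2 := by
  have h : ‖X‖ = √(∑ i, ∑ j, X i j ^ 2) := by
    have := Matrix.frobenius_norm_def X
    rw [Real.sqrt_eq_rpow]
    simpa using this
  rw [h, Real.sq_sqrt (by positivity), Fintype.sum_prod_type]

theorem abs_entry_le_norm {n : ℕ} (X : Matrix (Fin n) (Fin n) ℝ) (i j : Fin n) :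
    |X i j| ≤ ‖X‖ := by
  refine abs_le_of_sq_le_sq ?_ (norm_nonneg _)
  rw [frobenius_norm_sq]
  exact Finset.single_le_sum (f := fun p : Fin n × Fin n => X p.1 p.2 ^ 2)
    (fun p _ => sq_nonneg _) (Finset.mem_univ (i, j))

theorem norm_le_sum_abs {n : ℕ} (X : Matrix (Fin n) (Fin n) ℝ) :
    ‖X‖ ≤ ∑ i, ∑ j, |X i j| := by
  refine le_of_sq_le_sq ?_ (by positivity)
  rw [frobenius_norm_sq, ← Fintype.sum_prod_type' (f := fun i j => |X i j|)]
  simpa using Finset.sum_sq_le_sq_sum_of_nonneg (s := Finset.univ)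
    (f := fun p : Fin n × Fin n => |X p.1 p.2|) fun p _ => abs_nonneg _

/-- The Sylvester operator `X ↦ S X + X T` is bounded below. -/
theorem le_norm_sylvester {n : ℕ} {S T : Matrix (Fin n) (Fin n) ℝ} {c : ℝ}
    (hS : ∀ x : Fin n → ℝ, c * (x ⬝ᵥ x) ≤ x ⬝ᵥ (S *ᵥ x)) (hT : T.PosSemidef)
    (X : Matrix (Fin n) (Fin n) ℝ) : c * ‖X‖ ≤ ‖S * X + X * T‖ := by
  -- In the Frobenius inner product, ⟨X, SX⟩ is a sum over columns of X and ⟨X, XT⟩ a sum over rows.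
  -- The first is at least c‖X‖², the second nonnegative; Cauchy–Schwarz concludes.
  have h1 : c * ‖X‖ ^ 2 ≤ ∑ p : Fin n × Fin n, X p.1 p.2 * (S * X) p.1 p.2 := by
    rw [frobenius_norm_sq, Fintype.sum_prod_type_right, Fintype.sum_prod_type_right,
      Finset.mul_sum]
    refine Finset.sum_le_sum fun j _ => ?_
    have := hS (fun i => X i j)
    simpa [dotProduct, mulVec, Matrix.mul_apply, pow_two] using this
  have h2 : 0 ≤ ∑ p : Fin n × Fin n, X p.1 p.2 * (X * T) p.1 p.2 := by
    rw [Fintype.sum_prod_type]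
    refine Finset.sum_nonneg fun i _ => ?_
    have h3 := hT.dotProduct_mulVec_nonneg (fun j => X i j)
    have h4 : ∀ j k, T j k = T k j := fun j k => by simpa using (hT.1.apply j k).symm
    simp only [star_trivial, dotProduct, mulVec] at h3
    simp only [Matrix.mul_apply]
    refine h3.trans_eq (Finset.sum_congr rfl fun j _ => ?_)
    congr 1
    refine Finset.sum_congr rfl fun k _ => ?_
    rw [h4 j k, mul_comm]
  have h4 : ∑ p : Fin n × Fin n, X p.1 p.2 * (S * X + X * T) p.1 p.2
      ≤ ‖X‖ * ‖S * X + X * T‖ := by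
    refine abs_le_of_sq_le_sq' ?_ (by positivity) |>.2
    rw [mul_pow, frobenius_norm_sq, frobenius_norm_sq]
    exact Finset.sum_mul_sq_le_sq_mul_sq _ _ _
  simp only [Matrix.add_apply, mul_add, Finset.sum_add_distrib] at h4
  rcases (norm_nonneg X).eq_or_lt with h5 | h5
  · rw [← h5, mul_zero]
    exact norm_nonneg _
  · refine le_of_mul_le_mul_left ?_ h5
    calc ‖X‖ * (c * ‖X‖) = c * ‖X‖ ^ 2 := by ring
      _ ≤ _ := by linarith

theorem differentiableAt_matrix {n : ℕ} {g : EuclideanSpace ℝ (Fin n) → Matrix (Fin n) (Fin n) ℝ}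
    {y : EuclideanSpace ℝ (Fin n)} :
    DifferentiableAt ℝ g y ↔ ∀ i j, DifferentiableAt ℝ (fun y => g y i j) y := by
  constructor
  · intro h i j
    exact (LinearMap.toContinuousLinearMap
      (Matrix.entryLinearMap ℝ ℝ i j)).differentiableAt.comp y h
  · intro h
    rw [show g = fun y => ∑ i, ∑ j, g y i j • Matrix.single i j (1 : ℝ) by
      funext y
      conv_lhs => rw [Matrix.matrix_eq_sum_single (g y)]
      simp]
    exact DifferentiableAt.fun_sum fun i _ => DifferentiableAt.fun_sum fun j _ =>
      (h i j).smul_const _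

/-- A Lipschitz square root of a matrix field is differentiable wherever the field is. -/
theorem differentiableAt_sqrt {n : ℕ} {g e : EuclideanSpace ℝ (Fin n) → Matrix (Fin n) (Fin n) ℝ}
    (hsq : ∀ y, e y * e y = g y) (hpos : ∀ y, (e y).PosSemidef) {K : ℝ}
    (hK : ∀ y z, ‖e y - e z‖ ≤ K * ‖y - z‖) {c : ℝ} (hc : 0 < c)
    (hlow : ∀ y, ∀ x : Fin n → ℝ, c * (x ⬝ᵥ x) ≤ x ⬝ᵥ (e y *ᵥ x))
    {y : EuclideanSpace ℝ (Fin n)} (hg : DifferentiableAt ℝ g y) : DifferentiableAt ℝ e y := by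
  let L : Matrix (Fin n) (Fin n) ℝ →ₗ[ℝ] Matrix (Fin n) (Fin n) ℝ :=
    LinearMap.mulLeft ℝ (e y) + LinearMap.mulRight ℝ (e y)
  have hL : ∀ X, L X = e y * X + X * e y := fun X => rfl
  have hinj : Function.Injective L := by
    refine (injective_iff_map_eq_zero L).2 fun X hX => ?_
    have h1 := le_norm_sylvester (hlow y) (hpos y) X
    rw [← hL, hX, norm_zero] at h1
    exact norm_le_zero_iff.1 (nonpos_of_mul_nonpos_right h1 hc)
  let Le := (LinearEquiv.ofInjectiveEndo L hinj).toContinuousLinearEquiv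
  have hLe : ∀ X, Le X = L X := fun X => rfl
  -- With h = e(z) - e(y), squaring gives g(z) - g(y) = L h + h². Inverting L expresses e through g
  -- and the remainder h², which is O(|z - y|²) by the Lipschitz bound and hence differentiable at
  -- y.
  have heq : e = fun z => e y + Le.symm (g z - g y - (e z - e y) * (e z - e y)) := by
    funext z
    have : g z - g y - (e z - e y) * (e z - e y) = Le (e z - e y) := by
      rw [hLe, hL, ← hsq, ← hsq]
      noncomm_ring
    rw [this, ContinuousLinearEquiv.symm_apply_apply, add_sub_cancel]
  have hO : (fun z => (e z - e y) * (e z - e y)) =O[𝓝 y] fun z => ‖z - y‖ ^ 2 := by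
    refine Asymptotics.IsBigO.of_bound (K * K) (Eventually.of_forall fun z => ?_)
    refine (norm_mul_le _ _).trans ?_
    calc ‖e z - e y‖ * ‖e z - e y‖ ≤ (K * ‖z - y‖) * (K * ‖z - y‖) :=
          mul_self_le_mul_self (norm_nonneg _) (hK z y)
      _ = K * K * ‖‖z - y‖ ^ 2‖ := by rw [norm_pow, norm_norm]; ring
  have hq : DifferentiableAt ℝ (fun z => (e z - e y) * (e z - e y)) y :=
    (hO.hasFDerivAt (by norm_num)).differentiableAt
  rw [heq]
  exact (Le.symm.differentiableAt.comp y ((hg.sub_const (g y)).sub hq)).const_add (e y)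

theorem differentiableAt_matrix_inv {n : ℕ}
    {e : EuclideanSpace ℝ (Fin n) → Matrix (Fin n) (Fin n) ℝ} {y : EuclideanSpace ℝ (Fin n)}
    (he : DifferentiableAt ℝ e y) (hu : IsUnit (e y)) :
    DifferentiableAt ℝ (fun z => (e z)⁻¹) y := by
  have : CompleteSpace (Matrix (Fin n) (Fin n) ℝ) := FiniteDimensional.complete ℝ _
  obtain ⟨a, ha⟩ := hu
  have h1 : DifferentiableAt ℝ (Ring.inverse (M₀ := Matrix (Fin n) (Fin n) ℝ)) (e y) :=
    ha ▸ (hasFDerivAt_ringInverse a).differentiableAt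
  simp only [Matrix.nonsing_inv_eq_ringInverse]
  exact h1.comp y he

/-- A uniformly positive `W^{1,∞}` metric is `eᵀ e` for an invertible `W^{1,∞}` frame `e`. -/
theorem exists_frame {n : ℕ} {g : EuclideanSpace ℝ (Fin n) → Matrix (Fin n) (Fin n) ℝ}
    (hgpos : ∀ y, (g y).PosDef) (hg : ∀ i j, MemW1inf (fun y => g y i j))
    (hginv : ∀ i j, MemW1inf (fun y => (g y)⁻¹ i j)) :
    ∃ e : EuclideanSpace ℝ (Fin n) → Matrix (Fin n) (Fin n) ℝ,
      (∀ i j, MemW1inf (fun y => e y i j)) ∧ (∀ y, (e y)ᵀ * e y = g y) ∧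
      (∀ y, IsUnit (e y)) ∧ (∀ i j, MemW1inf (fun y => (e y)⁻¹ i j)) ∧
      ∀ y, (∀ k l, DifferentiableAt ℝ (fun y => g y k l) y) →
        ∀ i j, DifferentiableAt ℝ (fun y => e y i j) y ∧
          DifferentiableAt ℝ (fun y => (e y)⁻¹ i j) y := by
  choose e hpos hsq using fun y => exists_posSemidef_sqrt (hgpos y)
  have hsym : ∀ y, (e y)ᵀ = e y := fun y => by simpa using (hpos y).1.eq
  have hee : ∀ y, (e y)ᵀ * e y = g y := fun y => by rw [hsym, hsq]
  have hdet : ∀ y, IsUnit (e y).det := fun y => by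
    have h1 : IsUnit (e y * e y).det := (isUnit_iff_isUnit_det _).1 (hsq y ▸ (hgpos y).isUnit)
    rw [det_mul] at h1
    exact isUnit_of_mul_isUnit_left h1
  have hunit : ∀ y, IsUnit (e y) := fun y => (isUnit_iff_isUnit_det _).2 (hdet y)
  choose hK hC using hg
  choose K hK using hK
  choose C hC using hC
  choose C' hC' using fun i j => (hginv i j).2
  have hC'0 : ∀ i j, 0 ≤ C' i j := fun i j => (abs_nonneg _).trans (hC' i j 0)
  set M := ∑ i, ∑ j, C' i j with hM
  have hM0 : 0 ≤ M := Finset.sum_nonneg fun i _ => Finset.sum_nonneg fun j _ => hC'0 i j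
  have hCM : ∀ y i j, |(g y)⁻¹ i j| ≤ M := fun y i j =>
    (hC' i j y).trans ((Finset.single_le_sum (fun j _ => hC'0 i j) (Finset.mem_univ j)).trans
      (Finset.single_le_sum (f := fun i => ∑ j, C' i j)
        (fun i _ => Finset.sum_nonneg fun j _ => hC'0 i j) (Finset.mem_univ i)))
  have hlow : ∀ y, ∀ x : Fin n → ℝ, (1 + n * M)⁻¹ * (x ⬝ᵥ x) ≤ x ⬝ᵥ (e y *ᵥ x) := fun y x =>
    le_dotProduct_sqrt_mulVec (hgpos y) (hpos y) (hsq y) hM0 (hCM y) x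
  have hκ0 : 0 < 1 + n * M := by positivity
  set N : ℝ≥0 := (1 + n * M).toNNReal * ∑ i, ∑ j, K i j with hN
  have hLip : ∀ y z, ‖e y - e z‖ ≤ N * ‖y - z‖ := fun y z => by
    have h1 := le_norm_sylvester (hlow y) (hpos z) (e y - e z)
    have h2 : e y * (e y - e z) + (e y - e z) * e z = g y - g z := by
      rw [← hsq, ← hsq]
      noncomm_ring
    rw [h2, inv_mul_le_iff₀ hκ0] at h1
    refine h1.trans ?_
    rw [hN, NNReal.coe_mul, Real.coe_toNNReal _ hκ0.le, mul_assoc]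
    refine mul_le_mul_of_nonneg_left ((norm_le_sum_abs _).trans ?_) hκ0.le
    simp only [NNReal.coe_sum, Finset.sum_mul]
    refine Finset.sum_le_sum fun i _ => Finset.sum_le_sum fun j _ => ?_
    simpa [dist_eq_norm] using (hK i j).dist_le_mul y z
  have heW : ∀ i j, MemW1inf (fun y => e y i j) := fun i j => by
    -- The bound `C j j + 1` comes from e_{ij}² ≤ (eᵀe)_{jj} = g_{jj} and 2t ≤ t² + 1.
    refine ⟨⟨N, LipschitzWith.of_dist_le_mul fun y z => ?_⟩, C j j + 1, fun y => ?_⟩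
    · rw [Real.dist_eq, dist_eq_norm]
      exact (abs_entry_le_norm (e y - e z) i j).trans (hLip y z)
    · have h1 : e y i j ^ 2 ≤ g y j j := by
        rw [← hee, Matrix.mul_apply]
        simp only [transpose_apply, ← pow_two]
        exact Finset.single_le_sum (f := fun i => e y i j ^ 2) (fun i _ => sq_nonneg _)
          (Finset.mem_univ i)
      have h2 := (le_abs_self _).trans (hC j j y)
      nlinarith [sq_abs (e y i j), sq_nonneg (|e y i j| - 1), abs_nonneg (e y i j)]
  -- Writing e⁻¹ = g⁻¹eᵀ makes its entries sums of products of bounded Lipschitz functions.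
  have hinv : ∀ y, (e y)⁻¹ = (g y)⁻¹ * (e y)ᵀ := fun y => by
    refine Matrix.inv_eq_left_inv ?_
    rw [Matrix.mul_assoc, hee, Matrix.nonsing_inv_mul]
    exact (isUnit_iff_isUnit_det _).1 (hgpos y).isUnit
  refine ⟨e, heW, hee, hunit, fun i j => ?_, fun y hy i j => ?_⟩
  · simp only [hinv, Matrix.mul_apply, transpose_apply]
    exact MemW1inf.sum _ fun k => (hginv i k).mul (heW j k)
  · have h1 : DifferentiableAt ℝ e y :=
      differentiableAt_sqrt hsq hpos hLip (inv_pos.2 hκ0) hlow (differentiableAt_matrix.2 hy)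
    exact ⟨differentiableAt_matrix.1 h1 i j,
      differentiableAt_matrix.1 (differentiableAt_matrix_inv h1 (hunit y)) i j⟩

end SquareRoot

/-! ### Pointwise moving-frame algebra, with G = AᵀA, B = A⁻¹, d = ∇u and w = Ad. -/

section Algebra

variable {n : ℕ} {A B G : Matrix (Fin n) (Fin n) ℝ} {d w : Fin n → Plane}

theorem sum_smul_frame (hBA : B * A = 1) (hw : ∀ q, w q = ∑ l, A q l • d l) (k : Fin n) :
    ∑ q, B k q • w q = d k := by
  simp only [hw, Finset.smul_sum, smul_smul]
  rw [Finset.sum_comm]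
  simp only [← Finset.sum_smul, ← Matrix.mul_apply, hBA, Matrix.one_apply, ite_smul, one_smul,
    zero_smul, Finset.sum_ite_eq, Finset.mem_univ, if_true]

theorem sum_smul_metric (hG : A.transpose * A = G) (hw : ∀ q, w q = ∑ l, A q l • d l)
    (j : Fin n) : ∑ k, G j k • d k = ∑ p, A p j • w p := by
  simp only [hw, Finset.smul_sum, smul_smul]
  rw [Finset.sum_comm]
  refine Finset.sum_congr rfl fun k _ => ?_
  rw [← Finset.sum_smul, ← hG, Matrix.mul_apply]
  simp only [Matrix.transpose_apply]

/-- BᵀG = (AB)ᵀA = A: this is why Bᵀ is the right multiplier for the system. -/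
theorem sum_inverse_smul_metric (hAB : A * B = 1) (hG : A.transpose * A = G)
    (hw : ∀ q, w q = ∑ l, A q l • d l) (i : Fin n) :
    ∑ j, B j i • ∑ k, G j k • d k = w i := by
  simp only [sum_smul_metric hG hw, Finset.smul_sum, smul_smul]
  rw [Finset.sum_comm]
  simp only [← Finset.sum_smul, mul_comm (B _ i), ← Matrix.mul_apply, hAB, Matrix.one_apply,
    ite_smul, one_smul, zero_smul, Finset.sum_ite_eq', Finset.mem_univ, if_true]

/-- Substituting d = Bw on the right produces the conjugation BᵀZB, which preserves antisymmetry. -/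
theorem sum_inner_conj_frame (hBA : B * A = 1) (hw : ∀ q, w q = ∑ l, A q l • d l)
    (Z : Fin n → Fin n → Plane) (i : Fin n) :
    ∑ q, inner ℝ (∑ j, ∑ k, (B j i * B k q) • Z j k) (w q)
      = ∑ j, B j i * ∑ k, inner ℝ (Z j k) (d k) := by
  simp only [sum_inner, Finset.mul_sum]
  rw [Finset.sum_comm]
  refine Finset.sum_congr rfl fun j _ => ?_
  rw [Finset.sum_comm]
  refine Finset.sum_congr rfl fun k _ => ?_
  rw [← sum_smul_frame hBA hw k, inner_sum, Finset.mul_sum]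
  refine Finset.sum_congr rfl fun q _ => ?_
  rw [real_inner_smul_left, inner_smul_right]
  ring

/-- The two halves of the derivative of AᵀA contribute equally, because the inner product is
symmetric in k and l. -/
theorem sum_metric_deriv {dg : Fin n → Fin n → ℝ} {dA : Fin n → Fin n → ℝ}
    (hdg : ∀ k l, dg k l = ∑ p, (dA p k * A p l + A p k * dA p l))
    (hw : ∀ q, w q = ∑ l, A q l • d l) :
    ∑ k, ∑ l, dg k l * inner ℝ (d k) (d l) = 2 * ∑ k, ∑ p, dA p k * inner ℝ (w p) (d k) := by
  have h1 : ∀ a : Fin n → Fin n → ℝ, ∑ k, ∑ p, a p k * inner ℝ (w p) (d k)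
      = ∑ k, ∑ l, ∑ p, a p k * A p l * inner ℝ (d k) (d l) := fun a => by
    refine Finset.sum_congr rfl fun k _ => ?_
    rw [Finset.sum_comm]
    refine Finset.sum_congr rfl fun p _ => ?_
    rw [hw, sum_inner, Finset.mul_sum]
    refine Finset.sum_congr rfl fun l _ => ?_
    rw [real_inner_smul_left, real_inner_comm]
    ring
  have h2 : ∑ k, ∑ l, ∑ p, dA p k * A p l * inner ℝ (d k) (d l)
      = ∑ k, ∑ l, ∑ p, A p k * dA p l * inner ℝ (d k) (d l) := by
    rw [Finset.sum_comm]
    refine Finset.sum_congr rfl fun k _ => Finset.sum_congr rfl fun l _ =>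
      Finset.sum_congr rfl fun p _ => ?_
    rw [real_inner_comm]
    ring
  rw [two_mul, h1]
  nth_rewrite 2 [h2]
  simp only [hdg, Finset.sum_mul, ← Finset.sum_add_distrib, add_mul]

/-- Since Gd = Aᵀw, only A ∂B enters, and differentiating AB = 1 replaces it by -(∂A)B. -/
theorem sum_inner_inverse_deriv {dA dB : Fin n → Matrix (Fin n) (Fin n) ℝ}
    (hG : A.transpose * A = G) (hw : ∀ q, w q = ∑ l, A q l • d l)
    (hdB : ∀ m p i, ∑ j, (dA m p j * B j i + A p j * dB m j i) = 0) (i : Fin n) :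
    ∑ j, inner ℝ (∑ m, dB m j i • d m) (∑ k, G j k • d k)
      = -∑ j, B j i * ∑ k, ∑ p, dA k p j * inner ℝ (w p) (d k) := by
  have h1 : ∑ j, inner ℝ (∑ m, dB m j i • d m) (∑ k, G j k • d k)
      = ∑ m, ∑ p, (∑ j, A p j * dB m j i) * inner ℝ (w p) (d m) := by
    simp only [sum_smul_metric hG hw, sum_inner, inner_sum, Finset.sum_mul]
    rw [Finset.sum_comm]
    conv_rhs => rw [Finset.sum_comm]
    refine Finset.sum_congr rfl fun m _ => ?_
    rw [Finset.sum_comm]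
    refine Finset.sum_congr rfl fun p _ => Finset.sum_congr rfl fun j _ => ?_
    rw [real_inner_smul_left, inner_smul_right, real_inner_comm]
    ring
  have h2 : ∀ m p, ∑ j, A p j * dB m j i = -∑ j, dA m p j * B j i := fun m p => by
    have := hdB m p i
    rw [Finset.sum_add_distrib] at this
    linarith
  rw [h1]
  simp only [h2, neg_mul, Finset.sum_neg_distrib, Finset.mul_sum, Finset.sum_mul]
  rw [neg_inj]
  symm
  rw [Finset.sum_comm]
  refine Finset.sum_congr rfl fun m _ => ?_
  rw [Finset.sum_comm]
  refine Finset.sum_congr rfl fun p _ => Finset.sum_congr rfl fun j _ => ?_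
  ring

/-- The connection form that turns the Euler-Lagrange system into a system in the moving frame. -/
noncomputable def connection (dA : Fin n → Matrix (Fin n) (Fin n) ℝ) (w : Fin n → Plane)
    (Ω : Fin n → Fin n → Plane) (j k : Fin n) : Plane :=
  ∑ p, (dA j p k - dA k p j) • w p - (1 / 2 : ℝ) • Ω j k

theorem connection_antisymm {dA : Fin n → Matrix (Fin n) (Fin n) ℝ} {Ω : Fin n → Fin n → Plane}
    (hΩ : ∀ j k, Ω j k = -Ω k j) (j k : Fin n) :
    connection dA w Ω j k = -connection dA w Ω k j := by
  rw [connection, connection, hΩ j k, neg_sub, smul_neg, sub_neg_eq_add, sub_eq_add_neg,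
    ← Finset.sum_neg_distrib, add_comm]
  congr 1
  refine Finset.sum_congr rfl fun p _ => ?_
  rw [← neg_smul, neg_sub]

theorem sum_inner_connection (dA : Fin n → Matrix (Fin n) (Fin n) ℝ) (w : Fin n → Plane)
    (Ω : Fin n → Fin n → Plane) (j : Fin n) :
    ∑ k, inner ℝ (connection dA w Ω j k) (d k)
      = ∑ k, ∑ p, dA j p k * inner ℝ (w p) (d k) - ∑ k, ∑ p, dA k p j * inner ℝ (w p) (d k)
        - 1 / 2 * ∑ k, inner ℝ (Ω j k) (d k) := by
  simp only [connection, inner_sub_left, sum_inner, real_inner_smul_left, Finset.sum_sub_distrib,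
    Finset.mul_sum, sub_mul]

/-- The metric derivative supplies the ∂_j A_{pk} half of the connection and the derivative of B
supplies the -∂_k A_{pj} half. The factors 2 in both cancel against the prefactor -1/2, which
survives only on Ω and P. -/
theorem frame_identity {dg dA : Fin n → Matrix (Fin n) (Fin n) ℝ}
    {dB : Fin n → Matrix (Fin n) (Fin n) ℝ} (hBA : B * A = 1)
    (hG : A.transpose * A = G) (hw : ∀ q, w q = ∑ l, A q l • d l)
    (hdg : ∀ j k l, dg j k l = ∑ p, (dA j p k * A p l + A p k * dA j p l))
    (hdB : ∀ m p i, ∑ j, (dA m p j * B j i + A p j * dB m j i) = 0)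
    (Ω : Fin n → Fin n → Plane) (P : Fin n → ℝ) (i : Fin n) :
    -(1 / 2) * ∑ j, (B j i * (∑ k, inner ℝ (Ω j k) (d k) + P j
        - ∑ k, ∑ l, dg j k l * inner ℝ (d k) (d l))
        + inner ℝ (∑ m, dB m j i • d m) (-∑ k, (2 * G j k) • d k))
      = ∑ q, inner ℝ (∑ j, ∑ k, (B j i * B k q) • connection dA w Ω j k) (w q)
        - 1 / 2 * ∑ j, B j i * P j := by
  have h1 : ∀ j, inner ℝ (∑ m, dB m j i • d m) (-∑ k, (2 * G j k) • d k)
      = -2 * inner ℝ (∑ m, dB m j i • d m) (∑ k, G j k • d k) := fun j => by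
    simp only [mul_smul, ← Finset.smul_sum, inner_neg_right, inner_smul_right]
    ring
  rw [sum_inner_conj_frame hBA hw]
  simp only [h1, sum_inner_connection, fun j => sum_metric_deriv (hdg j) hw]
  rw [Finset.sum_add_distrib, ← Finset.mul_sum, sum_inner_inverse_deriv hG hw hdB]
  simp only [mul_add, mul_sub, Finset.sum_add_distrib, Finset.sum_sub_distrib,
    mul_left_comm (B _ i), ← Finset.mul_sum]
  ring

end Algebra

/-! ### Derivatives of matrix products and integrability of the connection form. -/

section System

theorem pderiv_sum_mul {n : ℕ} {a b : Fin n → EuclideanSpace ℝ (Fin n) → ℝ}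
    {y : EuclideanSpace ℝ (Fin n)} (ha : ∀ p, DifferentiableAt ℝ (a p) y)
    (hb : ∀ p, DifferentiableAt ℝ (b p) y) (i : Fin n) :
    pderiv i (fun y => ∑ p, a p y * b p y) y
      = ∑ p, (pderiv i (a p) y * b p y + a p y * pderiv i (b p) y) := by
  rw [pderiv, fderiv_fun_sum fun p _ => (ha p).fun_mul (hb p), sum_apply]
  refine Finset.sum_congr rfl fun p _ => ?_
  rw [fderiv_fun_mul (ha p) (hb p)]
  simp only [add_apply, smul_apply, smul_eq_mul, pderiv]
  ring

theorem memLp_perp {S : Set Plane} {F : Plane → Plane} (hF : MemLp F 2 (volume.restrict S)) :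
    MemLp (fun x => perp (F x)) 2 (volume.restrict S) := by
  let L : Plane →ₗ[ℝ] Plane :=
    { toFun := perp
      map_add' := fun v w => by
        ext i
        fin_cases i <;> simp [perp, add_comm]
      map_smul' := fun c v => by
        ext i
        fin_cases i <;> simp [perp] }
  exact (LinearMap.toContinuousLinearMap L).comp_memLp' hF

theorem memLp_connection {n : ℕ} {S : Set Plane} {dA : Plane → Fin n → Matrix (Fin n) (Fin n) ℝ}
    {w : Fin n → Plane → Plane} {Ω : Fin n → Fin n → Plane → Plane}
    (hdA : ∀ m p q, MemLp (fun x => dA x m p q) ⊤ (volume.restrict S))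
    (hw : ∀ p, MemLp (w p) 2 (volume.restrict S))
    (hΩ : ∀ j k, MemLp (Ω j k) 2 (volume.restrict S)) (j k : Fin n) :
    MemLp (fun x => connection (dA x) (fun p => w p x) (fun j k => Ω j k x) j k) 2
      (volume.restrict S) := by
  have h1 : ∀ p, MemLp (fun x => (dA x j p k - dA x k p j) • w p x) 2 (volume.restrict S) :=
    fun p => (hw p).smul ((hdA j p k).sub (hdA k p j))
  have h2 : MemLp (fun x => (1 / 2 : ℝ) • Ω j k x) 2 (volume.restrict S) :=
    (hΩ j k).const_smul (1 / 2 : ℝ)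
  have h3 : MemLp (fun x => ∑ p, (dA x j p k - dA x k p j) • w p x) 2 (volume.restrict S) :=
    memLp_finsetSum _ fun p _ => h1 p
  exact h3.sub h2

theorem IsWeakDiv.const_mul {D : Set Plane} {X : Plane → Plane} {f : Plane → ℝ}
    (h : IsWeakDiv D X f) (c : ℝ) : IsWeakDiv D (fun x => c • X x) (fun x => c * f x) := by
  refine ⟨h.1.smul c, h.2.1.smul c, fun φ hφ => ?_⟩
  simp only [real_inner_smul_left, mul_assoc, integral_const_mul, h.2.2 φ hφ, mul_neg]

end System

end RiviereForm

/-! ### Assembly of the transformed system. -/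

open RiviereForm

theorem mainTheorem2 {n : ℕ} (D : Set RiviereForm.Plane) (hD : IsOpen D) (hDfin : volume D < ⊤)
    (g : EuclideanSpace ℝ (Fin n) → Matrix (Fin n) (Fin n) ℝ)
    (hgpos : ∀ y, (g y).PosDef)
    (hg : ∀ i j, RiviereForm.MemW1inf (fun y => g y i j))
    (hginv : ∀ i j, RiviereForm.MemW1inf (fun y => (g y)⁻¹ i j))
    (b : Fin n → Fin n → RiviereForm.Plane → ℝ)
    (db : Fin n → Fin n → RiviereForm.Plane → RiviereForm.Plane)
    (hb : ∀ i k, RiviereForm.HasW12Grad D (b i k) (db i k))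
    (Ω : Fin n → Fin n → RiviereForm.Plane → RiviereForm.Plane)
    (hΩ : RiviereForm.IsAntisymmL2 D Ω)
    (u : RiviereForm.Plane → EuclideanSpace ℝ (Fin n))
    (du : Fin n → RiviereForm.Plane → RiviereForm.Plane)
    (hu : ∀ k, RiviereForm.HasW12Grad D (fun x => u x k) (du k))
    (hdiff : ∀ᵐ x ∂(volume.restrict D), (∀ k, du k x = 0) ∨
      ∀ k l, DifferentiableAt ℝ (fun y => g y k l) (u x))
    (hsol : RiviereForm.IsWeakSolution D g Ω db u du) :
    ∃ (e : EuclideanSpace ℝ (Fin n) → Matrix (Fin n) (Fin n) ℝ)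
      (A : RiviereForm.Plane → Matrix (Fin n) (Fin n) ℝ)
      (Ωt : Fin n → Fin n → RiviereForm.Plane → RiviereForm.Plane),
      (∀ i j, RiviereForm.MemW1inf (fun y => e y i j)) ∧
      (∀ y, (e y).transpose * e y = g y) ∧
      (∀ x, A x = e (u x)) ∧
      (∀ x, IsUnit (A x)) ∧
      (∀ i j, RiviereForm.MemW12 D (fun x => A x i j) ∧
        MemLp (fun x => A x i j) ⊤ (volume.restrict D)) ∧
      (∀ i j, RiviereForm.MemW12 D (fun x => (A x)⁻¹ i j) ∧
        MemLp (fun x => (A x)⁻¹ i j) ⊤ (volume.restrict D)) ∧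
      RiviereForm.IsAntisymmL2 D Ωt ∧
      ∀ i, RiviereForm.IsWeakDiv D
        (fun x => ∑ k, A x i k • du k x)
        (fun x => ∑ k, inner ℝ (Ωt i k x) (∑ l, A x k l • du l x)
          - (1 / 2) * ∑ j, (A x)⁻¹ j i * RiviereForm.perpTerm db du j x) := by
  have hfin : IsFiniteMeasure (volume.restrict D) := ⟨by simpa using hDfin⟩
  obtain ⟨e, he, hee, hunit, hinv, hde⟩ := exists_frame hgpos hg hginv
  have hum : AEStronglyMeasurable u (volume.restrict D) :=
    aestronglyMeasurable_of_coord fun k => (hu k).1.1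
  have hwL : ∀ q, MemLp (fun x => ∑ l, e (u x) q l • du l x) 2 (volume.restrict D) := fun q =>
    memLp_finsetSum _ fun l _ => (hu l).2.1.smul (memLp_top_comp hum (he q l))
  have hBL := fun i j => memLp_top_comp hum (hinv i j)
  have hBgrad : ∀ j i, HasW12Grad D (fun x => (e (u x))⁻¹ j i)
      (fun x => ∑ m, pderiv m (fun y => (e y)⁻¹ j i) (u x) • du m x) := fun j i =>
    hasW12Grad_comp hD hDfin hu (hinv j i)
      (hdiff.mono fun x hx => hx.imp id fun h => (hde _ h j i).2)
  have hYL : ∀ j, MemLp (fun x => -∑ k, (2 * g (u x) j k) • du k x) 2 (volume.restrict D) :=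
    fun j => (memLp_finsetSum _ fun k _ =>
      (hu k).2.1.smul ((memLp_top_comp hum (hg j k)).const_mul 2)).neg
  have hPI : ∀ j, IntegrableOn (perpTerm db du j) D := fun j =>
    integrable_finsetSum _ fun k _ => integrableOn_inner (memLp_perp (hb j k).2.1) (hu k).2.1
  have hfI : ∀ j, IntegrableOn (fun x => ∑ k, inner ℝ (Ω j k x) (du k x) + perpTerm db du j x
      - ∑ k, ∑ l, pderiv j (fun y => g y k l) (u x) * inner ℝ (du k x) (du l x)) D := fun j => by
    refine ((integrable_finsetSum _ fun k _ => integrableOn_inner (hΩ.1 j k) (hu k).2.1).add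
      (hPI j)).sub (integrable_finsetSum _ fun k _ => integrable_finsetSum _ fun l _ => ?_)
    obtain ⟨K, hK⟩ := (hg k l).1
    exact (integrableOn_inner (hu k).2.1 (hu l).2.1).bdd_mul (c := K)
      (memLp_top_pderiv_comp hum (hg k l) j).1 (Filter.Eventually.of_forall fun x =>
        abs_pderiv_le hK j (u x))
  -- Ω̃ is the connection form conjugated by B = e(u)⁻¹, that is BᵀωB.
  refine ⟨e, fun x => e (u x), fun i q x => ∑ j, ∑ k, ((e (u x))⁻¹ j i * (e (u x))⁻¹ k q) •
      connection (fun m => Matrix.of fun p q => pderiv m (fun y => e y p q) (u x))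
        (fun q => ∑ l, e (u x) q l • du l x) (fun j k => Ω j k x) j k,
    he, hee, fun x => rfl, fun x => hunit _, fun i j => ⟨⟨_, hasW12Grad_comp hD hDfin hu (he i j)
      (hdiff.mono fun x hx => hx.imp id fun h => (hde _ h i j).1)⟩, memLp_top_comp hum (he i j)⟩,
    fun i j => ⟨⟨_, hBgrad i j⟩, hBL i j⟩, ⟨fun i q => ?_, fun i q => ?_⟩, fun i => ?_⟩
  · have h1 := memLp_connection (S := D)
      (dA := fun x m => Matrix.of fun p q => pderiv m (fun y => e y p q) (u x))
      (fun m p q => memLp_top_pderiv_comp hum (he p q) m) hwL hΩ.1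
    refine memLp_finsetSum _ fun j _ => memLp_finsetSum _ fun k _ => ?_
    exact (h1 j k).smul (memLp_top_comp hum ((hinv j i).mul (hinv k q)))
  · have h1 : ∀ᵐ x ∂(volume.restrict D), ∀ j k, Ω j k x = -Ω k j x :=
      ae_all_iff.2 fun j => ae_all_iff.2 fun k => hΩ.2 j k
    filter_upwards [h1] with x hx
    rw [Finset.sum_comm, ← Finset.sum_neg_distrib]
    refine Finset.sum_congr rfl fun k _ => ?_
    rw [← Finset.sum_neg_distrib]
    refine Finset.sum_congr rfl fun j _ => ?_
    rw [connection_antisymm hx j k, smul_neg, mul_comm]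
  · have hBb : ∀ j, ∃ C, ∀ x, |(e (u x))⁻¹ j i| ≤ C := fun j =>
      (hinv j i).2.imp fun C hC x => hC (u x)
    choose C hC using hBb
    -- The j-th equation multiplied by B_{ji}; the product rule adds the term ∇B_{ji} · X_j, where
    -- X_j is the field under its divergence.
    have hterm := fun j => (hsol j).mul hD hDfin (hYL j) (hfI j) (hBgrad j i) (hC j)
    have hXI : ∀ j ∈ Finset.univ, IntegrableOn
        (fun x => (e (u x))⁻¹ j i • -∑ k, (2 * g (u x) j k) • du k x) D := fun j _ =>
      MemLp.integrable (q := 2) (by norm_num) ((hYL j).smul (hBL j i))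
    have hFI : ∀ j ∈ Finset.univ, IntegrableOn (fun x => (e (u x))⁻¹ j i *
        (∑ k, inner ℝ (Ω j k x) (du k x) + perpTerm db du j x
          - ∑ k, ∑ l, pderiv j (fun y => g y k l) (u x) * inner ℝ (du k x) (du l x))
        + inner ℝ (∑ m, pderiv m (fun y => (e y)⁻¹ j i) (u x) • du m x)
          (-∑ k, (2 * g (u x) j k) • du k x)) D := fun j _ =>
      ((hfI j).bdd_mul (c := C j) (hBL j i).1 (Filter.Eventually.of_forall (hC j))).add
        (integrableOn_inner (hBgrad j i).2.1 (hYL j))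
    have hAB : ∀ y, e y * (e y)⁻¹ = 1 := fun y =>
      Matrix.mul_nonsing_inv _ ((Matrix.isUnit_iff_isUnit_det _).1 (hunit y))
    have hBA : ∀ y, (e y)⁻¹ * e y = 1 := fun y =>
      Matrix.nonsing_inv_mul _ ((Matrix.isUnit_iff_isUnit_det _).1 (hunit y))
    refine ((IsWeakDiv.sum Finset.univ (fun j _ => hterm j) hXI hFI).const_mul (-(1 / 2))).congr
      (Filter.Eventually.of_forall fun x => ?_) ?_
      ((integrable_finsetSum _ hXI).smul (-(1 / 2) : ℝ))
      ((integrable_finsetSum _ hFI).const_mul (-(1 / 2) : ℝ))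
    · dsimp only
      rw [← sum_inverse_smul_metric (hAB (u x)) (hee (u x)) (fun q => rfl) i, Finset.smul_sum]
      refine Finset.sum_congr rfl fun j _ => ?_
      simp only [mul_smul, ← Finset.smul_sum, smul_neg]
      rw [smul_comm _ (2 : ℝ), smul_smul, ← neg_smul]
      norm_num
    · filter_upwards [hdiff] with x hx
      rcases hx with hx | hx
      -- Where all gradients vanish both sides are zero, so the identities for the derivatives of
      -- `e` are needed only at points of differentiability.
      · simp [hx, perpTerm]
      · have key := frame_identity (B := (e (u x))⁻¹) (d := fun k => du k x)
          (dg := fun j => Matrix.of fun k l => pderiv j (fun y => g y k l) (u x))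
          (dA := fun m => Matrix.of fun p q => pderiv m (fun y => e y p q) (u x))
          (dB := fun m => Matrix.of fun p q => pderiv m (fun y => (e y)⁻¹ p q) (u x))
          (hBA (u x)) (hee (u x)) (fun q => rfl) (fun j k l => ?_) (fun m p i => ?_)
          (fun j k => Ω j k x) (fun j => perpTerm db du j x) i
        · exact key
        · have h1 : (fun y => g y k l) = fun y => ∑ p, e y p k * e y p l := by
            funext y
            rw [← hee, Matrix.mul_apply]
            rfl
          simp only [Matrix.of_apply, h1]
          exact pderiv_sum_mul (fun p => (hde _ hx p k).1) (fun p => (hde _ hx p l).1) j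
        · have h1 : (fun y => ∑ j, e y p j * (e y)⁻¹ j i)
              = fun _ => (1 : Matrix (Fin n) (Fin n) ℝ) p i := by
            funext y
            rw [← Matrix.mul_apply, hAB]
          simp only [Matrix.of_apply]
          rw [← pderiv_sum_mul (fun j => (hde _ hx p j).1) (fun j => (hde _ hx j i).2) m, h1]
          simp [pderiv]
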